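/- \textbf{Setting.} Consider a finite-horizon constrained MDP with finite state space $\mathcal S$ ($|\mathcal S|=S$), finite action space $\mathcal A$ ($|\mathcal A|=A$), horizon $H$, initial distribution $p$, transition kernel $P(s'\mid s,a,h)$, $h\in[H]$ (with the convention $P(\cdot\mid s,a,H)=p$), and reward and cost functions $f,g:\mathcal S\times\mathcal A\times[H]\to[0,1]$. For a policy $\pi(a\mid s,h)$, a transition kernel $Q$ and $\ell:\mathcal S\times\mathcal A\times[H]\to\mathbb R$, let $V_1^\pi(\ell,Q)=\mathbb E\big[\sum_{h=1}^H\ell(s_h,a_h,h)\big]$, where $s_1\sim p$, $a_h\sim\pi(\cdot\mid s_h,h)$, $s_{h+1}\sim Q(\cdot\mid s_h,a_h,h)$. Let $\bar C\in(0,H)$ be the budget and $\pi_b$ a known baseline policy with known cost $\bar C_b=V_1^{\pi_b}(g,P)<\bar C$. Over $K$ episodes the agent plays policies $\pi_1,\dots,\pi_K$; in episode $k$ it observes the trajectory $s_1,a_1,\dots,s_H,a_H,s_{H+1}$ generated by $P,\pi_k$, and the values at the visited $(s_h,a_h,h)$ of $f_k=f+\zeta_k^f$ and $g_k=g+\zeta_k^g$,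 where the noise variables $\zeta_k^f(s,a,h),\zeta_k^g(s,a,h)$ are independent, have mean zero and satisfy $\mathbb E[e^{\lambda\zeta}]\le e^{\lambda^2/4}$ for all $\lambda\in\mathbb R$; the noise of episode $k$ is independent of the earlier episodes and of the trajectory of episode $k$. \textbf{Estimators.} Let $\delta\in(0,1)$ and $L=\ln(HSAK/\delta)$. Let $n_j(s,a,h)$ be the indicator that episode $j$ visits $(s,a)$ at step $h$, let $N_k(s,a,h)=\sum_{j<k}n_j(s,a,h)$, let $M_k(s,a,s',h)$ be the number of episodes $j<k$ that visit $(s,a)$ at step $h$ and then move to $s'$, and let $D_k=\max\{1,N_k-1\}$. Put $$\bar P_k(s'\mid s,a,h)=\frac{M_k(s,a,s',h)}{\max\{1,N_k(s,a,h)\}},\quad \bar f_k=\frac{\sum_{j<k}f_jn_j}{\max\{1,N_k\}},\quad \bar g_k=\frac{\sum_{j<k}g_jn_j}{\max\{1,N_k\}},\quad R_k=\sqrt{\frac{L}{\max\{1,N_k\}}},$$ $$\epsilon_k(s'\mid s,a,h)=2\sqrt{\frac{\bar P_k(s'\mid s,a,h)L}{D_k(s,a,h)}}+\frac{14L}{3D_k(s,a,h)},\qquad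 \varepsilon_k=2\sqrt{\frac{SL}{D_k}}+\frac{14SL}{3D_k},$$ $$U_k=8\sqrt H\,\varepsilon_k+4S\sqrt{HA/K}+\frac{2\sqrt{HK/A}\,L+\eta}{D_k},\qquad \eta=(19HS+2H^{1.5}S+10^4H^2S^2)L^2,$$ $$\widehat g_k=\bar g_k+R_k+U_k,\qquad \widehat f_k=\min\Big\{1+\sqrt L,\ \bar f_k+\tfrac{3H}{\bar C-\bar C_b}R_k+\tfrac{H}{\bar C-\bar C_b}U_k\Big\},$$ and let $\mathcal P_k$ be the set of transition kernels $Q$ with $|Q-\bar P_k|\le\epsilon_k$ at all $(s,a,s',h)$. \textbf{DOPE+} with $K_0$ initial episodes plays $\pi_k=\pi_b$ for $k\le K_0$, and for $k>K_0$ it takes $$(\pi_k,P_k)\in\operatorname{argmax}\big\{V_1^\pi(\widehat f_k,Q):\ \pi\text{ a policy},\ Q\in\mathcal P_k,\ V_1^\pi(\widehat g_k,Q)\le\bar C\big\}.\tag{LP}$$ We say that DOPE+ computes the policy of episode $k$ if $k\le K_0$ or (LP) is feasible in episode $k$; if (LP) is infeasible, DOPE+ computes no policy and an arbitrary (history-dependent)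 policy is played in that episode. \textbf{Theorem.} For every $K$ and every $K_0\ge0$, there is an event of probability at least $1-14\delta$ on which the following hold. (i) Every policy $\pi_k$, $k\in[K]$, computed by DOPE+ satisfies the true constraint $V_1^{\pi_k}(g,P)\le\bar C$. (ii) If all $K$ policies are computed by DOPE+, then $\mathrm{Violation}(\vec\pi):=\sum_{k=1}^K\max\{0,V_1^{\pi_k}(g,P)-\bar C\}=0$. (iii) DOPE+ computes the policy of every episode $k\in[K]$ such that $k\le K_0$ or $V_1^{\pi_b}(2R_k+U_k,P)\le\bar C-\bar C_b$. In particular, if $K_0$ is such that the latter inequality holds for all $K_0<k\le K$, then all $K$ policies are computed and $\mathrm{Violation}(\vec\pi)=0$. -/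

import Mathlib

open MeasureTheory ProbabilityTheory

noncomputable section

namespace DOPEPlus

/-! ### Policies, transition kernels, trajectories, value functions

Steps `1, …, H` are indexed by `Fin H`. -/

/-- `π s h a` is `π(a ∣ s, h)`. -/
abbrev Pol (S A : Type*) (H : ℕ) := S → Fin H → A → ℝ

/-- `Q s a h s'` is `Q(s' ∣ s, a, h)`. -/
abbrev Ker (S A : Type*) (H : ℕ) := S → A → Fin H → S → ℝ

/-- Functions `ℓ(s, a, h)`. -/
abbrev Fn (S A : Type*) (H : ℕ) := S → A → Fin H → ℝ

/-- States `s_1, …, s_{H+1}` and actions `a_1, …, a_H` of one episode. -/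
abbrev Traj (S A : Type*) (H : ℕ) := (Fin (H + 1) → S) × (Fin H → A)

/-- The set `Π` of valid policies. -/
def IsPolicy {S A : Type*} [Fintype A] {H : ℕ} (π : Pol S A H) : Prop :=
  ∀ s h, (∀ a, 0 ≤ π s h a) ∧ ∑ a, π s h a = 1

/-- Valid transition kernels. -/
def IsKernel {S A : Type*} [Fintype S] {H : ℕ} (Q : Ker S A H) : Prop :=
  ∀ s a h, (∀ s', 0 ≤ Q s a h s') ∧ ∑ s', Q s a h s' = 1

/-- Probability of a trajectory: `s_1 ∼ p`, `a_h ∼ π(· ∣ s_h, h)`, `s_{h+1} ∼ Q(· ∣ s_h, a_h, h)`. -/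
def trajProb {S A : Type*} {H : ℕ} (p : S → ℝ) (π : Pol S A H) (Q : Ker S A H)
    (τ : Traj S A H) : ℝ :=
  p (τ.1 0) * ∏ h : Fin H,
    (π (τ.1 h.castSucc) h (τ.2 h) * Q (τ.1 h.castSucc) (τ.2 h) h (τ.1 h.succ))

/-- `V_1^π(ℓ, Q)`: the expectation of `∑_h ℓ(s_h, a_h, h)` over the trajectory generated by
`p`, `π` and `Q`. -/
def value {S A : Type*} [Fintype S] [Fintype A] [DecidableEq S] [DecidableEq A] {H : ℕ}
    (p : S → ℝ) (π : Pol S A H) (ℓ : Fn S A H) (Q : Ker S A H) : ℝ :=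
  ∑ τ : Traj S A H, trajProb p π Q τ * ∑ h : Fin H, ℓ (τ.1 h.castSucc) (τ.2 h) h

/-- A finite-horizon constrained MDP.  As a convention the transition out of the last step is
governed by the initial distribution. -/
structure CMDP (S A : Type*) [Fintype S] [Fintype A] (H : ℕ) where
  init : S → ℝ
  init_nonneg : ∀ s, 0 ≤ init s
  init_sum : ∑ s, init s = 1
  trans : Ker S A H
  trans_isKernel : IsKernel trans
  trans_last : ∀ s a s' (h : Fin H), h.val + 1 = H → trans s a h s' = init s'
  reward : Fn S A H
  reward_mem : ∀ s a h, reward s a h ∈ Set.Icc (0 : ℝ) 1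
  cost : Fn S A H
  cost_mem : ∀ s a h, cost s a h ∈ Set.Icc (0 : ℝ) 1
  /-- The budget `C̄`. -/
  budget : ℝ

/-! ### Observed histories and the estimators -/

/-- The record of one episode: trajectory, observed rewards, observed costs at steps `1, …, H`. -/
abbrev Episode (S A : Type*) (H : ℕ) := Traj S A H × (Fin H → ℝ) × (Fin H → ℝ)

/-- The records of the first `k` episodes. -/
abbrev Hist (S A : Type*) (H k : ℕ) := Fin k → Episode S A H

section Estimators

variable {S A : Type*} [Fintype S] [Fintype A] [DecidableEq S] [DecidableEq A] {H k : ℕ}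

/-- `n_j(s, a, h)`: indicator of a visit to `(s, a)` at step `h`. -/
def visit (e : Episode S A H) (s : S) (a : A) (h : Fin H) : ℕ :=
  if e.1.1 h.castSucc = s ∧ e.1.2 h = a then 1 else 0

/-- `N(s, a, h)`: number of visits in the recorded episodes. -/
def countN (w : Hist S A H k) (s : S) (a : A) (h : Fin H) : ℕ :=
  ∑ j, visit (w j) s a h

/-- `M(s, a, s', h)`: number of visits to `(s, a)` at step `h` followed by `s'`. -/
def countM (w : Hist S A H k) (s : S) (a : A) (s' : S) (h : Fin H) : ℕ :=
  ∑ j, if (w j).1.1 h.succ = s' then visit (w j) s a h else 0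

/-- The empirical kernel `P̄`. -/
def empKer (w : Hist S A H k) : Ker S A H := fun s a h s' =>
  (countM w s a s' h : ℝ) / max 1 (countN w s a h : ℝ)

/-- The empirical reward `f̄`. -/
def empReward (w : Hist S A H k) : Fn S A H := fun s a h =>
  (∑ j, (w j).2.1 h * (visit (w j) s a h : ℝ)) / max 1 (countN w s a h : ℝ)

/-- The empirical cost `ḡ`. -/
def empCost (w : Hist S A H k) : Fn S A H := fun s a h =>
  (∑ j, (w j).2.2 h * (visit (w j) s a h : ℝ)) / max 1 (countN w s a h : ℝ)

/-- `ln(HSAK/δ)`. -/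
def logTerm (S A : Type*) [Fintype S] [Fintype A] (H K : ℕ) (δ : ℝ) : ℝ :=
  Real.log ((H : ℝ) * (Fintype.card S : ℝ) * (Fintype.card A : ℝ) * (K : ℝ) / δ)

/-- `max{1, N(s, a, h) - 1}`. -/
def den (w : Hist S A H k) (s : S) (a : A) (h : Fin H) : ℝ :=
  max 1 ((countN w s a h : ℝ) - 1)

/-- The confidence radius `ϵ(s' ∣ s, a, h)` for transitions. -/
def radiusKer (K : ℕ) (δ : ℝ) (w : Hist S A H k) : Ker S A H := fun s a h s' =>
  2 * Real.sqrt (empKer w s a h s' * logTerm S A H K δ / den w s a h)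
    + 14 * logTerm S A H K δ / (3 * den w s a h)

/-- The confidence set of transition kernels. -/
def confSet (K : ℕ) (δ : ℝ) (w : Hist S A H k) : Set (Ker S A H) :=
  {Q | IsKernel Q ∧ ∀ s a h s', |Q s a h s' - empKer w s a h s'| ≤ radiusKer K δ w s a h s'}

/-- The confidence radius `R(s, a, h)` for rewards and costs. -/
def radiusFn (K : ℕ) (δ : ℝ) (w : Hist S A H k) : Fn S A H := fun s a h =>
  Real.sqrt (logTerm S A H K δ / max 1 (countN w s a h : ℝ))

/-- The function `ε(s, a, h)`. -/
def varEps (K : ℕ) (δ : ℝ) (w : Hist S A H k) : Fn S A H := fun s a h =>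
  2 * Real.sqrt ((Fintype.card S : ℝ) * logTerm S A H K δ / den w s a h)
    + 14 * (Fintype.card S : ℝ) * logTerm S A H K δ / (3 * den w s a h)

/-- The constant `η`. -/
def eta (S A : Type*) [Fintype S] [Fintype A] (H K : ℕ) (δ : ℝ) : ℝ :=
  (19 * (H : ℝ) * (Fintype.card S : ℝ) + 2 * (H : ℝ) ^ (3 / 2 : ℝ) * (Fintype.card S : ℝ)
    + 10 ^ 4 * (H : ℝ) ^ 2 * (Fintype.card S : ℝ) ^ 2) * (logTerm S A H K δ) ^ 2

/-- The extra pessimism `U(s, a, h)`. -/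
def bonusU (K : ℕ) (δ : ℝ) (w : Hist S A H k) : Fn S A H := fun s a h =>
  8 * Real.sqrt (H : ℝ) * varEps K δ w s a h
    + 4 * (Fintype.card S : ℝ) * Real.sqrt ((H : ℝ) * (Fintype.card A : ℝ) / (K : ℝ))
    + (2 * Real.sqrt ((H : ℝ) * (K : ℝ) / (Fintype.card A : ℝ)) * logTerm S A H K δ
        + eta S A H K δ) / den w s a h

/-- The pessimistic cost estimator `ĝ`. -/
def pessCost (K : ℕ) (δ : ℝ) (w : Hist S A H k) : Fn S A H := fun s a h =>
  empCost w s a h + radiusFn K δ w s a h + bonusU K δ w s a h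

/-- The optimistic reward estimator `f̂`; `gap` is `C̄ - C̄_b`. -/
def optReward (K : ℕ) (δ gap : ℝ) (w : Hist S A H k) : Fn S A H := fun s a h =>
  min (1 + Real.sqrt (logTerm S A H K δ))
    (empReward w s a h + 3 * (H : ℝ) / gap * radiusFn K δ w s a h
      + (H : ℝ) / gap * bonusU K δ w s a h)

/-- The feasible set of the optimization problem solved after the recorded episodes. -/
def feasibleSet (p : S → ℝ) (C : ℝ) (K : ℕ) (δ : ℝ) (w : Hist S A H k) :
    Set (Pol S A H × Ker S A H) :=
  {x | IsPolicy x.1 ∧ x.2 ∈ confSet K δ w ∧ value p x.1 (pessCost K δ w) x.2 ≤ C}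

/-- The set of optimal solutions of that problem. -/
def solutionSet (p : S → ℝ) (C : ℝ) (K : ℕ) (δ gap : ℝ) (w : Hist S A H k) :
    Set (Pol S A H × Ker S A H) :=
  {x | x ∈ feasibleSet p C K δ w ∧ IsMaxOn
    (fun y : Pol S A H × Ker S A H => value p y.1 (optReward K δ gap w) y.2)
    (feasibleSet p C K δ w) x}

end Estimators

/-! ### Learners and the law of a run -/

/-- A learner computes, after `k` recorded episodes, the policy for the next episode (and an
estimated kernel) as a function of these records. -/
structure Learner (S A : Type*) [Fintype A] [MeasurableSpace S] [MeasurableSpace A] (H : ℕ) where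
  policy : (k : ℕ) → Hist S A H k → Pol S A H
  kernel : (k : ℕ) → Hist S A H k → Ker S A H
  policy_isPolicy : ∀ k w, IsPolicy (policy k w)
  policy_measurable : ∀ k, Measurable (policy k)

/-- The learner runs DOPE+ for `K` episodes with `K₀` initial episodes: the baseline policy in the
first `K₀` episodes, then an optimal solution of the optimization problem in every episode in
which that problem has a feasible point.  (DOPE+ does not say what to do if it has none; the
learner may then play anything, and the policy does not count as computed by DOPE+, see
`Computed`.)  The episode that follows `k` recorded ones has number `k + 1`. -/
def IsDOPEPlus {S A : Type*} [Fintype S] [Fintype A] [DecidableEq S] [DecidableEq A]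
    [MeasurableSpace S] [MeasurableSpace A] {H : ℕ} (M : CMDP S A H) (πb : Pol S A H)
    (K K₀ : ℕ) (δ : ℝ) (L : Learner S A H) : Prop :=
  ∀ k, k < K → ∀ w : Hist S A H k,
    (k < K₀ → L.policy k w = πb) ∧
    (K₀ ≤ k → (feasibleSet M.init M.budget K δ w).Nonempty →
      (L.policy k w, L.kernel k w) ∈ solutionSet M.init M.budget K δ
        (M.budget - value M.init πb M.cost M.trans) w)

/-- After the records `w` of `k` episodes, DOPE+ does compute a policy. -/
def Computed {S A : Type*} [Fintype S] [Fintype A] [DecidableEq S] [DecidableEq A]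
    {H : ℕ} (M : CMDP S A H) (K K₀ : ℕ) (δ : ℝ) {k : ℕ} (w : Hist S A H k) : Prop :=
  k < K₀ ∨ (feasibleSet M.init M.budget K δ w).Nonempty

/-- Zero-mean `1/2`-sub-Gaussian noise distributions: `𝔼 exp(t ζ) ≤ exp(t² / 4)`. -/
def IsNoise (ν : Measure ℝ) : Prop :=
  IsProbabilityMeasure ν ∧ ∫ x, x ∂ν = 0 ∧ HasSubgaussianMGF (fun x : ℝ => x) (1 / 2) ν

section Run

variable {S A : Type*} [Fintype S] [Fintype A] [DecidableEq S] [DecidableEq A]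
  [MeasurableSpace S] [MeasurableSpace A] {H : ℕ}

/-- Law of the trajectory of an episode in which `π` is played. -/
def trajLaw (M : CMDP S A H) (π : Pol S A H) : Measure (Traj S A H) :=
  ∑ τ : Traj S A H, ENNReal.ofReal (trajProb M.init π M.trans τ) • Measure.dirac τ

/-- What is recorded for a trajectory `τ` and noise tables `ζ^f`, `ζ^g`. -/
def observe (M : CMDP S A H)
    (x : Traj S A H × ((S × A × Fin H → ℝ) × (S × A × Fin H → ℝ))) : Episode S A H :=
  (x.1,
    fun h => M.reward (x.1.1 h.castSucc) (x.1.2 h) h + x.2.1 (x.1.1 h.castSucc, x.1.2 h, h),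
    fun h => M.cost (x.1.1 h.castSucc) (x.1.2 h) h + x.2.2 (x.1.1 h.castSucc, x.1.2 h, h))

/-- Law of the record of an episode in which `π` is played: the noise variables `ζ^f(s, a, h)`,
`ζ^g(s, a, h)`, with distributions `νf (s, a, h)`, `νg (s, a, h)`, are independent of each other
and of the trajectory. -/
def episodeLaw (M : CMDP S A H) (νf νg : S × A × Fin H → Measure ℝ) (π : Pol S A H) :
    Measure (Episode S A H) :=
  ((trajLaw M π).prod ((Measure.pi νf).prod (Measure.pi νg))).map (observe M)

/-- Law of the records of the first `k` episodes when the learner `L` interacts with `M`. -/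
def runLaw (M : CMDP S A H) (νf νg : ℕ → S × A × Fin H → Measure ℝ) (L : Learner S A H) :
    (k : ℕ) → Measure (Hist S A H k)
  | 0 => Measure.dirac (fun j => j.elim0)
  | k + 1 => (runLaw M νf νg L k).bind fun w =>
      (episodeLaw M (νf k) (νg k) (L.policy k w)).map fun e =>
        (Fin.snoc w e : Hist S A H (k + 1))

end Run

/-- The policy played in episode `k + 1` of a run with records `ω`. -/
def playedPolicy {S A : Type*} [Fintype A] [MeasurableSpace S] [MeasurableSpace A] {H K : ℕ}
    (L : Learner S A H) (ω : Hist S A H K) (k : Fin K) : Pol S A H :=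
  L.policy k (Fin.take k k.isLt.le ω)

/-- The hard constraint violation of `K` policies. -/
def violation {S A : Type*} [Fintype S] [Fintype A] [DecidableEq S] [DecidableEq A] {H K : ℕ}
    (M : CMDP S A H) (π : Fin K → Pol S A H) : ℝ :=
  ∑ k, max 0 (value M.init (π k) M.cost M.trans - M.budget)

end DOPEPlus

end

/-! Safety holds because the pessimism `U` pays for the model error. By the simulation lemma,
`V(g, P) - V(g, Q)` is the expected sum, under `Q`, of `(P - Q) · V^P`. If `P` and
`Q` lie in the same confidence set, a Bernstein bound controls each summand by the standard
deviation of `V^P` under `Q`, up to lower-order terms; after AM-GM with a tilt `θ`, the accumulated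
variances telescope along the trajectory (law of total variance) and are absorbed up to `θ H`,
leaving at most `V(U, Q)`. Hence a policy that is feasible for the pessimistic costs and some `Q` in
the confidence set is feasible for the true model. Conversely, pessimism costs the baseline policy
at most `V(2 R + U, P)`, so within that slack the pair of the baseline policy and `P` is feasible.

The confidence sets hold simultaneously with high probability: for each `(s, a, h)` and each number
`n` of visits, the exponential of a tilted sum over the first `n` visits is a supermartingale. As
the tilt may depend on `n`, a union bound over `n ≤ K` replaces the union bound over episodes. -/

namespace DOPEPlus

section Trajectories

variable {S A : Type*} [Fintype S] [Fintype A] {H : ℕ} {p : S → ℝ}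

lemma trajProb_nonneg {π : Pol S A H} {Q : Ker S A H} (hp : ∀ s, 0 ≤ p s) (hπ : IsPolicy π)
    (hQ : IsKernel Q) (τ : Traj S A H) : 0 ≤ trajProb p π Q τ :=
  mul_nonneg (hp _) (Finset.prod_nonneg fun _ _ => mul_nonneg ((hπ _ _).1 _) ((hQ _ _ _).1 _))

lemma trajProb_snoc {S A : Type*} {H : ℕ} (p : S → ℝ) (π : Pol S A (H + 1)) (Q : Ker S A (H + 1))
    (τ : Traj S A H) (a : A) (s' : S) :
    trajProb p π Q ((Fin.snoc τ.1 s' : Fin (H + 1 + 1) → S), (Fin.snoc τ.2 a : Fin (H + 1) → A))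
      = trajProb p (fun s h => π s h.castSucc) (fun s a h => Q s a h.castSucc) τ
        * (π (τ.1 (Fin.last H)) (Fin.last H) a
          * Q (τ.1 (Fin.last H)) a (Fin.last H) s') := by
  have h_init : (Fin.snoc τ.1 s' : Fin (H + 1 + 1) → S) 0 = τ.1 0 :=
    Fin.snoc_castSucc (α := fun _ => S) s' τ.1 0
  simp only [trajProb, Fin.prod_univ_castSucc, Fin.snoc_castSucc, Fin.snoc_last, h_init,
    Fin.succ_last, Fin.succ_castSucc]
  ring

lemma sum_traj_zero (Φ : Traj S A 0 → ℝ) :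
    ∑ τ, Φ τ = ∑ s, Φ ((fun _ => s), (fun h => h.elim0)) := by
  rw [Fintype.sum_prod_type, ← (Equiv.funUnique (Fin 1) S).symm.sum_comp]
  refine Finset.sum_congr rfl fun s _ => ?_
  rw [Fintype.sum_unique]
  exact congrArg _ (Prod.ext rfl (Subsingleton.elim _ _))

lemma sum_traj_succ (Φ : Traj S A (H + 1) → ℝ) :
    ∑ τ, Φ τ = ∑ τ : Traj S A H, ∑ a, ∑ s',
      Φ ((Fin.snoc τ.1 s' : Fin (H + 1 + 1) → S), (Fin.snoc τ.2 a : Fin (H + 1) → A)) := by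
  rw [← ((Fin.snocEquiv fun _ : Fin (H + 1 + 1) => S).prodCongr
    (Fin.snocEquiv fun _ : Fin (H + 1) => A)).sum_comp]
  simp only [Fintype.sum_prod_type, Equiv.prodCongr_apply, Prod.map_apply]
  rw [Finset.sum_comm]
  exact Finset.sum_congr rfl fun _ _ =>
    Finset.sum_comm_cycle.trans <| Finset.sum_congr rfl fun _ _ => Finset.sum_comm

/-- The mean of `Φ` over the trajectory generated by `p`, `π` and `Q`; `value` is the special case
in which `Φ` accumulates a function of step, state and action. -/
noncomputable def trajMean (p : S → ℝ) (π : Pol S A H) (Q : Ker S A H) (Φ : Traj S A H → ℝ) : ℝ :=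
  ∑ τ, trajProb p π Q τ * Φ τ

section

variable {π : Pol S A H} {Q : Ker S A H}

lemma trajMean_mono (hp : ∀ s, 0 ≤ p s) (hπ : IsPolicy π) (hQ : IsKernel Q)
    {Φ Ψ : Traj S A H → ℝ} (h : ∀ τ, Φ τ ≤ Ψ τ) : trajMean p π Q Φ ≤ trajMean p π Q Ψ :=
  Finset.sum_le_sum fun τ _ => mul_le_mul_of_nonneg_left (h τ) (trajProb_nonneg hp hπ hQ τ)

lemma trajMean_sum {ι : Type*} (t : Finset ι) (Φ : ι → Traj S A H → ℝ) :
    trajMean p π Q (fun τ => ∑ i ∈ t, Φ i τ) = ∑ i ∈ t, trajMean p π Q (Φ i) := by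
  simp only [trajMean, Finset.mul_sum]
  exact Finset.sum_comm

end

lemma trajMean_snoc (π : Pol S A (H + 1)) (Q : Ker S A (H + 1)) (Φ : Traj S A (H + 1) → ℝ) :
    trajMean p π Q Φ
      = trajMean p (fun s h => π s h.castSucc) (fun s a h => Q s a h.castSucc) fun τ =>
        ∑ a, π (τ.1 (Fin.last H)) (Fin.last H) a
          * ∑ s', Q (τ.1 (Fin.last H)) a (Fin.last H) s'
            * Φ ((Fin.snoc τ.1 s' : Fin (H + 1 + 1) → S),
              (Fin.snoc τ.2 a : Fin (H + 1) → A)) := by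
  simp only [trajMean, sum_traj_succ, trajProb_snoc, Finset.mul_sum, mul_assoc]

lemma trajMean_init {π : Pol S A H} {Q : Ker S A H} (hπ : IsPolicy π) (hQ : IsKernel Q)
    (F : S → ℝ) : trajMean p π Q (fun τ => F (τ.1 0)) = ∑ s, p s * F s := by
  induction H with
  | zero => rw [trajMean, sum_traj_zero]; simp [trajProb]
  | succ H ih =>
    have h_init : ∀ (u : Fin (H + 1) → S) s', (Fin.snoc u s' : Fin (H + 1 + 1) → S) 0 = u 0 :=
      fun u s' => Fin.snoc_castSucc (α := fun _ => S) s' u 0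
    rw [trajMean_snoc, ← ih (fun s h => hπ s h.castSucc) (fun s a h => hQ s a h.castSucc)]
    simp only [h_init, ← Finset.sum_mul, (hQ _ _ _).2, (hπ _ _).2, one_mul]

lemma trajMean_step {π : Pol S A H} {Q : Ker S A H} (hπ : IsPolicy π) (hQ : IsKernel Q)
    (h : Fin H) (F : S → A → S → ℝ) :
    trajMean p π Q (fun τ => F (τ.1 h.castSucc) (τ.2 h) (τ.1 h.succ))
      = trajMean p π Q fun τ => ∑ a, π (τ.1 h.castSucc) h a
        * ∑ s', Q (τ.1 h.castSucc) a h s' * F (τ.1 h.castSucc) a s' := by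
  induction H with
  | zero => exact h.elim0
  | succ H ih =>
    rw [trajMean_snoc, trajMean_snoc]
    cases h using Fin.lastCases with
    | last =>
      simp only [Fin.snoc_castSucc, Fin.snoc_last, Fin.succ_last, ← Finset.sum_mul, (hQ _ _ _).2,
        (hπ _ _).2, one_mul]
    | cast h =>
      simp only [Fin.snoc_castSucc, Fin.succ_castSucc, ← Finset.sum_mul, (hQ _ _ _).2, (hπ _ _).2,
        one_mul]
      exact ih (fun s h => hπ s h.castSucc) (fun s a h => hQ s a h.castSucc) h

section

variable {π : Pol S A H} {Q : Ker S A H}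

lemma trajMean_const (hp : ∑ s, p s = 1) (hπ : IsPolicy π) (hQ : IsKernel Q) (c : ℝ) :
    trajMean p π Q (fun _ => c) = c := by
  rw [trajMean_init hπ hQ fun _ => c, ← Finset.sum_mul, hp, one_mul]

lemma trajMean_action (hπ : IsPolicy π) (hQ : IsKernel Q) (h : Fin H) (F : S → A → ℝ) :
    trajMean p π Q (fun τ => F (τ.1 h.castSucc) (τ.2 h))
      = trajMean p π Q fun τ => ∑ a, π (τ.1 h.castSucc) h a * F (τ.1 h.castSucc) a := by
  rw [trajMean_step hπ hQ h fun s a _ => F s a]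
  simp only [← Finset.sum_mul, (hQ _ _ _).2, one_mul]

lemma trajMean_next (hπ : IsPolicy π) (hQ : IsKernel Q) (h : Fin H) (F : S → A → S → ℝ) :
    trajMean p π Q (fun τ => F (τ.1 h.castSucc) (τ.2 h) (τ.1 h.succ))
      = trajMean p π Q fun τ =>
        ∑ s', Q (τ.1 h.castSucc) (τ.2 h) h s' * F (τ.1 h.castSucc) (τ.2 h) s' := by
  rw [trajMean_step hπ hQ, trajMean_action hπ hQ h fun s a => ∑ s', Q s a h s' * F s a s']

end

section Value

variable [DecidableEq S] [DecidableEq A]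

lemma value_eq_sum_trajMean (p : S → ℝ) (π : Pol S A H) (ℓ : Fn S A H) (Q : Ker S A H) :
    value p π ℓ Q = ∑ h, trajMean p π Q fun τ => ℓ (τ.1 h.castSucc) (τ.2 h) h :=
  trajMean_sum _ _

lemma value_add (p : S → ℝ) (π : Pol S A H) (Q : Ker S A H) (ℓ ℓ' : Fn S A H) :
    value p π (fun s a h => ℓ s a h + ℓ' s a h) Q = value p π ℓ Q + value p π ℓ' Q := by
  simp only [value, Finset.sum_add_distrib, mul_add]

lemma value_sub (p : S → ℝ) (π : Pol S A H) (Q : Ker S A H) (ℓ ℓ' : Fn S A H) :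
    value p π (fun s a h => ℓ s a h - ℓ' s a h) Q = value p π ℓ Q - value p π ℓ' Q := by
  simp only [value, Finset.sum_sub_distrib, mul_sub]

lemma value_smul (p : S → ℝ) (π : Pol S A H) (Q : Ker S A H) (c : ℝ) (ℓ : Fn S A H) :
    value p π (fun s a h => c * ℓ s a h) Q = c * value p π ℓ Q := by
  simp only [value, ← Finset.mul_sum, mul_left_comm _ c]

variable {π : Pol S A H} {Q : Ker S A H}

lemma value_const (hp : ∑ s, p s = 1) (hπ : IsPolicy π) (hQ : IsKernel Q) (c : ℝ) :
    value p π (fun _ _ _ => c) Q = H * c := by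
  simp [value_eq_sum_trajMean, trajMean_const hp hπ hQ]

lemma value_mono (hp : ∀ s, 0 ≤ p s) (hπ : IsPolicy π) (hQ : IsKernel Q) {ℓ ℓ' : Fn S A H}
    (h : ∀ s a h, ℓ s a h ≤ ℓ' s a h) : value p π ℓ Q ≤ value p π ℓ' Q :=
  trajMean_mono hp hπ hQ fun _ => Finset.sum_le_sum fun _ _ => h _ _ _

lemma value_nonneg (hp : ∀ s, 0 ≤ p s) (hπ : IsPolicy π) (hQ : IsKernel Q) {ℓ : Fn S A H}
    (h : ∀ s a h, 0 ≤ ℓ s a h) : 0 ≤ value p π ℓ Q :=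
  Finset.sum_nonneg fun τ _ =>
    mul_nonneg (trajProb_nonneg hp hπ hQ τ) (Finset.sum_nonneg fun _ _ => h _ _ _)

lemma value_increment (hπ : IsPolicy π) (hQ : IsKernel Q) (W : Fin (H + 1) → S → ℝ) :
    value p π (fun s a h => ∑ s', Q s a h s' * W h.succ s') Q
      - ∑ h : Fin H, trajMean p π Q (fun τ => W h.castSucc (τ.1 h.castSucc))
      = trajMean p π Q (fun τ => W (Fin.last H) (τ.1 (Fin.last H))) - ∑ s, p s * W 0 s := by
  have h_next : value p π (fun s a h => ∑ s', Q s a h s' * W h.succ s') Q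
      = ∑ h : Fin H, trajMean p π Q fun τ => W h.succ (τ.1 h.succ) := by
    rw [value_eq_sum_trajMean]
    exact Finset.sum_congr rfl fun h _ => (trajMean_next hπ hQ h fun _ _ => W h.succ).symm
  have h_split := (Fin.sum_univ_castSucc fun i => trajMean p π Q fun τ => W i (τ.1 i)).symm.trans
    (Fin.sum_univ_succ _)
  rw [h_next, ← trajMean_init hπ hQ (W 0)]
  linarith

end Value

end Trajectories

section WeightedMean

variable {ι : Type*} [Fintype ι] {q x : ι → ℝ}

lemma abs_sum_mul_le {c : ℝ} (hq : ∀ i, 0 ≤ q i) (hq1 : ∑ i, q i = 1) (hx : ∀ i, |x i| ≤ c) :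
    |∑ i, q i * x i| ≤ c :=
  calc |∑ i, q i * x i| ≤ ∑ i, |q i * x i| := Finset.abs_sum_le_sum_abs _ _
    _ ≤ ∑ i, q i * c := Finset.sum_le_sum fun i _ => by
        rw [abs_mul, abs_of_nonneg (hq i)]
        exact mul_le_mul_of_nonneg_left (hx i) (hq i)
    _ = c := by rw [← Finset.sum_mul, hq1, one_mul]

/-- The variance of `x` under the weights `q` of a probability distribution on a finite type. -/
noncomputable def weightedVariance (q x : ι → ℝ) : ℝ :=
  ∑ i, q i * (x i - ∑ j, q j * x j) ^ 2

lemma weightedVariance_eq_sub (hq1 : ∑ i, q i = 1) :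
    weightedVariance q x = ∑ i, q i * x i ^ 2 - (∑ i, q i * x i) ^ 2 := by
  have h_expand (m : ℝ) : ∑ i, q i * (x i - m) ^ 2
      = ∑ i, q i * x i ^ 2 - 2 * m * ∑ i, q i * x i + m ^ 2 := by
    rw [← one_mul (m ^ 2), ← hq1, Finset.mul_sum, Finset.sum_mul, ← Finset.sum_sub_distrib,
      ← Finset.sum_add_distrib]
    exact Finset.sum_congr rfl fun i _ => by ring
  rw [weightedVariance, h_expand]
  ring

lemma mul_le_mul_sq_mul_sq_add {q d e u θ B : ℝ} (hq : 0 ≤ q) (hd : 0 ≤ d) (hdB : d ≤ B)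
    (hθ : 0 < θ) (he : e ≤ 4 * √q * u + 23 * u ^ 2) :
    e * d ≤ θ * (q * d ^ 2) + (4 / θ + 23 * B) * u ^ 2 := by
  have h_amgm : 4 * √q * u * d ≤ θ * (q * d ^ 2) + 4 / θ * u ^ 2 := by
    have h_square : θ * (q * d ^ 2) + 4 / θ * u ^ 2 - 4 * √q * u * d
        = (θ * (√q * d) - 2 * u) ^ 2 / θ := by
      nth_rewrite 1 [← Real.sq_sqrt hq]
      field_simp
      ring
    have h_nonneg : 0 ≤ (θ * (√q * d) - 2 * u) ^ 2 / θ := by positivity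
    linarith
  calc e * d ≤ (4 * √q * u + 23 * u ^ 2) * d := mul_le_mul_of_nonneg_right he hd
    _ = 4 * √q * u * d + 23 * u ^ 2 * d := by ring
    _ ≤ θ * (q * d ^ 2) + 4 / θ * u ^ 2 + 23 * u ^ 2 * B := by gcongr
    _ = θ * (q * d ^ 2) + (4 / θ + 23 * B) * u ^ 2 := by ring

lemma abs_sum_sub_mul_le {q' : ι → ℝ} {u θ B : ℝ} (hq' : ∑ i, q' i = 1) (hq : ∀ i, 0 ≤ q i)
    (hq1 : ∑ i, q i = 1) (hθ : 0 < θ)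
    (hqq' : ∀ i, |q' i - q i| ≤ 4 * √(q i) * u + 23 * u ^ 2) (hx : ∀ i, |x i| ≤ B / 2) :
    |∑ i, (q' i - q i) * x i|
      ≤ θ * weightedVariance q x + (4 / θ + 23 * B) * Fintype.card ι * u ^ 2 := by
  set m := ∑ i, q i * x i
  have hmB : |m| ≤ B / 2 := abs_sum_mul_le hq hq1 hx
  have h_center : ∑ i, (q' i - q i) * x i = ∑ i, (q' i - q i) * (x i - m) := by
    simp only [mul_sub, Finset.sum_sub_distrib, ← Finset.sum_mul, hq', hq1]
    ring
  rw [h_center]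
  calc |∑ i, (q' i - q i) * (x i - m)| ≤ ∑ i, |(q' i - q i) * (x i - m)| :=
        Finset.abs_sum_le_sum_abs _ _
    _ ≤ ∑ i, (θ * (q i * (x i - m) ^ 2) + (4 / θ + 23 * B) * u ^ 2) := by
        refine Finset.sum_le_sum fun i _ => ?_
        have hd : |x i - m| ≤ B := (abs_sub _ _).trans (by linarith [hx i])
        rw [abs_mul, ← sq_abs (x i - m)]
        exact mul_le_mul_sq_mul_sq_add (hq i) (abs_nonneg _) hd hθ (hqq' i)
    _ = θ * weightedVariance q x + (4 / θ + 23 * B) * Fintype.card ι * u ^ 2 := by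
        rw [Finset.sum_add_distrib, ← Finset.mul_sum, Finset.sum_const, Finset.card_univ,
          nsmul_eq_mul, weightedVariance]
        ring

end WeightedMean

section Simulation

variable {S A : Type*} [Fintype S] [Fintype A] {H : ℕ}

/-- The value functions `V_h^π(ℓ, P)`, defined backwards from `V_{H+1} = 0`. -/
noncomputable def valueFn (π : Pol S A H) (ℓ : Fn S A H) (P : Ker S A H) : Fin (H + 1) → S → ℝ :=
  Fin.reverseInduction (motive := fun _ => S → ℝ) (fun _ => 0)
    fun h V s => ∑ a, π s h a * (ℓ s a h + ∑ s', P s a h s' * V s')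

lemma valueFn_last (π : Pol S A H) (ℓ : Fn S A H) (P : Ker S A H) (s : S) :
    valueFn π ℓ P (Fin.last H) s = 0 := by
  simp [valueFn]

lemma valueFn_castSucc (π : Pol S A H) (ℓ : Fn S A H) (P : Ker S A H) (h : Fin H) (s : S) :
    valueFn π ℓ P h.castSucc s
      = ∑ a, π s h a * (ℓ s a h + ∑ s', P s a h s' * valueFn π ℓ P h.succ s') := by
  simp [valueFn]

lemma abs_valueFn_le {π : Pol S A H} {ℓ : Fn S A H} {P : Ker S A H} (hπ : IsPolicy π)
    (hP : IsKernel P) {c : ℝ} (hℓ : ∀ s a h, |ℓ s a h| ≤ c) (i : Fin (H + 1)) (s : S) :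
    |valueFn π ℓ P i s| ≤ ((H : ℝ) - i) * c := by
  induction i using Fin.reverseInduction generalizing s with
  | last => simp [valueFn_last]
  | cast h ih =>
    rw [valueFn_castSucc]
    refine abs_sum_mul_le (hπ s h).1 (hπ s h).2 fun a => ?_
    have h_next := abs_sum_mul_le (hP s a h).1 (hP s a h).2 ih
    refine (abs_add_le _ _).trans ((add_le_add (hℓ s a h) h_next).trans_eq ?_)
    simp only [Fin.val_succ, Fin.val_castSucc]
    push_cast
    ring

lemma abs_valueFn_succ_le {π : Pol S A H} {ℓ : Fn S A H} {P : Ker S A H} (hπ : IsPolicy π)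
    (hP : IsKernel P) {c : ℝ} (hc : 0 ≤ c) (hℓ : ∀ s a h, |ℓ s a h| ≤ c) (h : Fin H) (s : S) :
    |valueFn π ℓ P h.succ s| ≤ ((H : ℝ) - 1) * c := by
  refine (abs_valueFn_le hπ hP hℓ h.succ s).trans (mul_le_mul_of_nonneg_right ?_ hc)
  rw [Fin.val_succ]
  push_cast
  linarith [(h : ℕ).cast_nonneg (α := ℝ)]

/-- The variance of the value function of `P` at the next state, drawn from `Q`. -/
noncomputable def nextVariance (π : Pol S A H) (ℓ : Fn S A H) (P Q : Ker S A H) : Fn S A H :=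
  fun s a h => weightedVariance (Q s a h) (valueFn π ℓ P h.succ)

/-- The one-step model error `(P - Q) V_{h+1}^π(ℓ, P)`. -/
noncomputable def modelError (π : Pol S A H) (ℓ : Fn S A H) (P Q : Ker S A H) : Fn S A H :=
  fun s a h => ∑ s', (P s a h s' - Q s a h s') * valueFn π ℓ P h.succ s'

lemma modelError_eq_sub (π : Pol S A H) (ℓ : Fn S A H) (P Q : Ker S A H) (s : S) (a : A)
    (h : Fin H) : modelError π ℓ P Q s a h
      = ∑ s', P s a h s' * valueFn π ℓ P h.succ s'
        - ∑ s', Q s a h s' * valueFn π ℓ P h.succ s' := by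
  simp only [modelError, sub_mul, Finset.sum_sub_distrib]

lemma sq_add_sub_sq_le {l x y B : ℝ} (hl : |l| ≤ 1 / 2) (hx : |x| ≤ (B - 1) * (1 / 2))
    (hy : |y| ≤ (B - 1) * (1 / 2)) : (l + x) ^ 2 - y ^ 2 ≤ B / 2 + B * |x - y| := by
  have h_sum : |l + x + y| ≤ B := (abs_add_three _ _ _).trans (by linarith)
  have h_diff : |l + (x - y)| ≤ 1 / 2 + |x - y| := (abs_add_le _ _).trans (by linarith)
  calc (l + x) ^ 2 - y ^ 2 = (l + (x - y)) * (l + x + y) := by ring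
    _ ≤ |l + (x - y)| * |l + x + y| := (le_abs_self _).trans_eq (abs_mul _ _)
    _ ≤ (1 / 2 + |x - y|) * B := mul_le_mul h_diff h_sum (abs_nonneg _) (by positivity)
    _ = B / 2 + B * |x - y| := by ring

variable [DecidableEq S] [DecidableEq A] {p : S → ℝ} {π : Pol S A H} {ℓ : Fn S A H}
  {P Q : Ker S A H}

lemma sum_trajMean_valueFn (hπ : IsPolicy π) (hQ : IsKernel Q) :
    ∑ h : Fin H, trajMean p π Q (fun τ => valueFn π ℓ P h.castSucc (τ.1 h.castSucc))
      = value p π ℓ Q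
        + value p π (fun s a h => ∑ s', P s a h s' * valueFn π ℓ P h.succ s') Q := by
  rw [← value_add, value_eq_sum_trajMean]
  refine Finset.sum_congr rfl fun h _ => ?_
  simp only [valueFn_castSucc]
  exact (trajMean_action hπ hQ h fun s a =>
    ℓ s a h + ∑ s', P s a h s' * valueFn π ℓ P h.succ s').symm

lemma value_increment_valueFn (hπ : IsPolicy π) (hQ : IsKernel Q) :
    value p π ℓ Q + value p π (modelError π ℓ P Q) Q = ∑ s, p s * valueFn π ℓ P 0 s := by
  have h_incr := value_increment (p := p) hπ hQ (valueFn π ℓ P)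
  have h_last : trajMean p π Q (fun τ => valueFn π ℓ P (Fin.last H) (τ.1 (Fin.last H))) = 0 := by
    simp [trajMean, valueFn_last]
  rw [sum_trajMean_valueFn hπ hQ, h_last] at h_incr
  simp only [funext₃ (modelError_eq_sub π ℓ P Q), value_sub]
  linarith

lemma value_sub_value (hπ : IsPolicy π) (hP : IsKernel P) (hQ : IsKernel Q) :
    value p π ℓ P - value p π ℓ Q = value p π (modelError π ℓ P Q) Q := by
  have h_self : value p π (modelError π ℓ P P) P = 0 := by simp [value, modelError]
  have hP_eq := value_increment_valueFn (p := p) (ℓ := ℓ) (P := P) hπ hP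
  have hQ_eq := value_increment_valueFn (p := p) (ℓ := ℓ) (P := P) hπ hQ
  linarith

lemma sum_trajMean_valueFn_sq_le (hp : ∀ s, 0 ≤ p s) (hπ : IsPolicy π) (hQ : IsKernel Q) :
    ∑ h : Fin H, trajMean p π Q (fun τ => valueFn π ℓ P h.castSucc (τ.1 h.castSucc) ^ 2)
      ≤ value p π (fun s a h =>
        (ℓ s a h + ∑ s', P s a h s' * valueFn π ℓ P h.succ s') ^ 2) Q := by
  rw [value_eq_sum_trajMean]
  refine Finset.sum_le_sum fun h _ => ?_
  rw [trajMean_action hπ hQ h fun s a =>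
    (ℓ s a h + ∑ s', P s a h s' * valueFn π ℓ P h.succ s') ^ 2]
  refine trajMean_mono hp hπ hQ fun τ => ?_
  rw [valueFn_castSucc]
  exact Real.pow_arith_mean_le_arith_mean_pow_of_even _ _ _ (fun a _ => (hπ _ h).1 a) (hπ _ h).2
    even_two

lemma value_nextVariance_le (hp : ∀ s, 0 ≤ p s) (hp1 : ∑ s, p s = 1) (hπ : IsPolicy π)
    (hP : IsKernel P) (hQ : IsKernel Q) (hℓ : ∀ s a h, |ℓ s a h| ≤ 1 / 2) :
    value p π (nextVariance π ℓ P Q) Q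
      ≤ H ^ 2 / 2 + H * value p π (fun s a h => |modelError π ℓ P Q s a h|) Q := by
  set W := valueFn π ℓ P with hW
  have h_incr := value_increment (p := p) hπ hQ fun i s => W i s ^ 2
  have h_last : trajMean p π Q (fun τ => W (Fin.last H) (τ.1 (Fin.last H)) ^ 2) = 0 := by
    simp [trajMean, hW, valueFn_last]
  have h_init : 0 ≤ ∑ s, p s * W 0 s ^ 2 :=
    Finset.sum_nonneg fun s _ => mul_nonneg (hp s) (sq_nonneg _)
  have h_jensen := sum_trajMean_valueFn_sq_le (ℓ := ℓ) (P := P) hp hπ hQ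
  have h_step : value p π (fun s a h => (ℓ s a h + ∑ s', P s a h s' * W h.succ s') ^ 2
        - (∑ s', Q s a h s' * W h.succ s') ^ 2) Q
      ≤ value p π (fun s a h => (H : ℝ) / 2 + H * |modelError π ℓ P Q s a h|) Q := by
    refine value_mono hp hπ hQ fun s a h => ?_
    have hWb := abs_valueFn_succ_le hπ hP one_half_pos.le hℓ h
    rw [modelError_eq_sub]
    exact sq_add_sub_sq_le (hℓ s a h) (abs_sum_mul_le (hP s a h).1 (hP s a h).2 hWb)
      (abs_sum_mul_le (hQ s a h).1 (hQ s a h).2 hWb)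
  have h_var : value p π (nextVariance π ℓ P Q) Q
      = value p π (fun s a h => ∑ s', Q s a h s' * W h.succ s' ^ 2) Q
        - value p π (fun s a h => (∑ s', Q s a h s' * W h.succ s') ^ 2) Q := by
    rw [← value_sub]
    exact congrArg (value p π · Q)
      (funext₃ fun s a h => weightedVariance_eq_sub (hQ s a h).2)
  rw [value_sub, value_add p π Q (fun _ _ _ => (H : ℝ) / 2), value_const hp1 hπ hQ, value_smul]
    at h_step
  linarith

lemma value_abs_modelError_le (hp : ∀ s, 0 ≤ p s) (hp1 : ∑ s, p s = 1) (hπ : IsPolicy π)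
    (hP : IsKernel P) (hQ : IsKernel Q) (hℓ : ∀ s a h, |ℓ s a h| ≤ 1 / 2) {u : Fn S A H}
    (hPQ : ∀ s a h s', |P s a h s' - Q s a h s'|
      ≤ 4 * √(Q s a h s') * u s a h + 23 * u s a h ^ 2)
    {θ : ℝ} (hθ : 0 < θ) (hθH : θ * H ≤ 1 / 2) :
    value p π (fun s a h => |modelError π ℓ P Q s a h|) Q
      ≤ value p π (fun s a h => θ * H
        + (8 / θ + 46 * H) * Fintype.card S * u s a h ^ 2) Q := by
  have h_step : value p π (fun s a h => |modelError π ℓ P Q s a h|) Q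
      ≤ value p π (fun s a h => θ * nextVariance π ℓ P Q s a h
        + (4 / θ + 23 * H) * Fintype.card S * u s a h ^ 2) Q := by
    refine value_mono hp hπ hQ fun s a h => ?_
    refine abs_sum_sub_mul_le (hP s a h).2 (hQ s a h).1 (hQ s a h).2 hθ
      (hPQ s a h) fun s' => (abs_valueFn_succ_le hπ hP one_half_pos.le hℓ h s').trans ?_
    linarith
  have h_nonneg : 0 ≤ value p π (fun s a h => |modelError π ℓ P Q s a h|) Q :=
    value_nonneg hp hπ hQ fun _ _ _ => abs_nonneg _
  rw [value_add, value_smul, value_smul] at h_step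
  rw [value_add p π Q (fun _ _ _ => θ * H), value_const hp1 hπ hQ, value_smul]
  set X := value p π (fun s a h => |modelError π ℓ P Q s a h|) Q
  set x := value p π (fun s a h => u s a h ^ 2) Q
  have h_var : θ * value p π (nextVariance π ℓ P Q) Q ≤ θ * (H ^ 2 / 2 + H * X) :=
    mul_le_mul_of_nonneg_left (value_nextVariance_le hp hp1 hπ hP hQ hℓ) hθ.le
  have h_absorb : θ * H * X ≤ 1 / 2 * X := mul_le_mul_of_nonneg_right hθH h_nonneg
  calc X = 2 * X - X := by ring
    _ ≤ 2 * (θ * (H ^ 2 / 2 + H * X) + (4 / θ + 23 * H) * Fintype.card S * x)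
        - 2 * (θ * H * X) := by linarith
    _ = H * (θ * H) + (8 / θ + 46 * H) * Fintype.card S * x := by ring

end Simulation

section Pessimism

lemma abs_sub_le_of_abs_sub_le_radius {x y r u : ℝ} (hy : 0 ≤ y) (hr : 0 ≤ r) (hu : 0 ≤ u)
    (hxr : |x - r| ≤ 2 * (√r * u) + 14 / 3 * u ^ 2)
    (hyr : |y - r| ≤ 2 * (√r * u) + 14 / 3 * u ^ 2) :
    |x - y| ≤ 4 * √y * u + 23 * u ^ 2 := by
  have hr_sq := Real.sq_sqrt hr
  have hy_sq := Real.sq_sqrt hy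
  have h_sq : (√r - u) ^ 2 ≤ (√y + 12 / 5 * u) ^ 2 := by
    nlinarith [(abs_le.1 hyr).1, mul_nonneg (Real.sqrt_nonneg y) hu, sq_nonneg u]
  have h_sqrt : √r - u ≤ √y + 12 / 5 * u :=
    (le_abs_self _).trans (abs_le_of_sq_le_sq h_sq (by positivity))
  have h_tri : |x - y| ≤ |x - r| + |y - r| := abs_sub_comm y r ▸ abs_sub_le x r y
  nlinarith [sq_nonneg u, mul_le_mul_of_nonneg_right h_sqrt hu]

/-- The variance term carries the factor `θ` and the lower-order term `1 / θ`; the balance is struck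
at `θ = 4 S √(A / (H K))`, capped at `1 / (2 H)` where the simulation argument stops working. -/
lemma exists_tilt_le_pessimism {H S A K L : ℝ} (hH : 0 < H) (hS : 0 < S) (hA : 0 < A)
    (hK : 0 < K) (hL : 0 ≤ L) :
    ∃ θ > 0, θ * H ≤ 1 / 2 ∧ ∀ D > 0, θ * H + (8 / θ + 46 * H) * S * (L / D)
      ≤ 4 * S * √(H * A / K) + (2 * √(H * K / A) * L + 62 * H * S * L) / D := by
  set r := √(H * A / K) with hr
  have hr_pos : 0 < r := Real.sqrt_pos.2 (by positivity)
  have hr_inv : √(H * K / A) = H / r := by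
    rw [eq_div_iff hr_pos.ne', hr, ← Real.sqrt_mul (by positivity),
      show H * K / A * (H * A / K) = H ^ 2 by field_simp, Real.sqrt_sq hH.le]
  rw [hr_inv]
  rcases le_or_gt (4 * S * r) (1 / 2) with h_small | h_large
  · refine ⟨4 * S * r / H, by positivity, by rwa [div_mul_cancel₀ _ hH.ne'], fun D hD => ?_⟩
    calc 4 * S * r / H * H + (8 / (4 * S * r / H) + 46 * H) * S * (L / D)
        = 4 * S * r + (2 * (H / r) * L + 46 * (H * S * L)) / D := by field_simp; ring
      _ ≤ 4 * S * r + (2 * (H / r) * L + 62 * (H * S * L)) / D := by gcongr; norm_num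
      _ = 4 * S * r + (2 * (H / r) * L + 62 * H * S * L) / D := by ring
  · refine ⟨1 / (2 * H), by positivity, by field_simp; rfl, fun D hD => ?_⟩
    calc 1 / (2 * H) * H + (8 / (1 / (2 * H)) + 46 * H) * S * (L / D)
        = 1 / 2 + (62 * H * S * L) / D := by field_simp; ring
      _ ≤ 4 * S * r + (2 * (H / r) * L + 62 * H * S * L) / D := by
        gcongr
        exact le_add_of_nonneg_left (by positivity)

section Counts

variable {S A : Type*} [DecidableEq S] [DecidableEq A] {H k : ℕ}

lemma den_pos (w : Hist S A H k) (s : S) (a : A) (h : Fin H) : 0 < den w s a h :=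
  one_pos.trans_le (le_max_left _ _)

lemma empKer_nonneg (w : Hist S A H k) (s : S) (a : A) (h : Fin H) (s' : S) :
    0 ≤ empKer w s a h s' := by
  unfold empKer
  positivity

end Counts

variable {S A : Type*} [Fintype S] [Fintype A] {H k K : ℕ} {δ : ℝ}

lemma le_eta [Nonempty S] (hH : 0 < H) (hL : 1 ≤ logTerm S A H K δ) :
    62 * (H : ℝ) * Fintype.card S * logTerm S A H K δ ≤ eta S A H K δ := by
  have hH' : (1 : ℝ) ≤ H := by exact_mod_cast hH
  have hS : (1 : ℝ) ≤ Fintype.card S := by exact_mod_cast Fintype.card_pos (α := S)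
  unfold eta
  set L := logTerm S A H K δ
  set c : ℝ := (Fintype.card S : ℝ)
  have h_one : 1 ≤ H * c * L :=
    one_le_mul_of_one_le_of_one_le (one_le_mul_of_one_le_of_one_le hH' hS) hL
  have h_rest : 0 ≤ (19 * (H : ℝ) * c + 2 * (H : ℝ) ^ (3 / 2 : ℝ) * c) * L ^ 2 := by positivity
  calc 62 * (H : ℝ) * c * L = 62 * (H * c * L) := by ring
    _ ≤ 10 ^ 4 * (H * c * L) ^ 2 := by nlinarith
    _ ≤ 10 ^ 4 * (H * c * L) ^ 2
        + (19 * (H : ℝ) * c + 2 * (H : ℝ) ^ (3 / 2 : ℝ) * c) * L ^ 2 := by linarith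
    _ = _ := by ring

variable [DecidableEq S] [DecidableEq A] {w : Hist S A H k}

lemma radiusKer_eq (hL : 0 ≤ logTerm S A H K δ) (w : Hist S A H k) (s : S) (a : A) (h : Fin H)
    (s' : S) :
    radiusKer K δ w s a h s'
      = 2 * (√(empKer w s a h s') * √(logTerm S A H K δ / den w s a h))
        + 14 / 3 * √(logTerm S A H K δ / den w s a h) ^ 2 := by
  have hD := den_pos w s a h
  rw [Real.sq_sqrt (div_nonneg hL hD.le), ← Real.sqrt_mul (empKer_nonneg w s a h s'), radiusKer,
    mul_div_assoc]
  congr 1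
  field_simp

lemma abs_sub_le_of_mem_confSet (hL : 0 ≤ logTerm S A H K δ) {P Q : Ker S A H}
    (hP : P ∈ confSet K δ w) (hQ : Q ∈ confSet K δ w) (s : S) (a : A) (h : Fin H) (s' : S) :
    |P s a h s' - Q s a h s'| ≤ 4 * √(Q s a h s') * √(logTerm S A H K δ / den w s a h)
      + 23 * √(logTerm S A H K δ / den w s a h) ^ 2 := by
  refine abs_sub_le_of_abs_sub_le_radius ((hQ.1 s a h).1 s') (empKer_nonneg w s a h s')
    (Real.sqrt_nonneg _) ?_ ?_ <;> rw [← radiusKer_eq hL]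
  exacts [hP.2 s a h s', hQ.2 s a h s']

lemma le_bonusU [Nonempty S] (hH : 0 < H) (hL : 1 ≤ logTerm S A H K δ) (w : Hist S A H k) (s : S)
    (a : A) (h : Fin H) :
    4 * (Fintype.card S : ℝ) * √(H * Fintype.card A / K)
        + (2 * √(H * K / Fintype.card A) * logTerm S A H K δ
          + 62 * H * Fintype.card S * logTerm S A H K δ) / den w s a h
      ≤ bonusU K δ w s a h := by
  have hD := den_pos w s a h
  have h_varEps : 0 ≤ 8 * √(H : ℝ) * varEps K δ w s a h := by
    unfold varEps
    positivity
  have h_eta := le_eta hH hL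
  rw [bonusU, add_assoc]
  refine le_add_of_nonneg_of_le h_varEps ?_
  gcongr

/-- Subtracting `1 / 2` from `g` leaves the difference of the two values unchanged and centres the
value functions, which the constants of the bonus need. -/
theorem value_le_value_add_bonusU [Nonempty S] [Nonempty A] (hH : 0 < H) (hK : 0 < K)
    (hL : 1 ≤ logTerm S A H K δ) {p : S → ℝ} (hp : ∀ s, 0 ≤ p s) (hp1 : ∑ s, p s = 1)
    {π : Pol S A H} (hπ : IsPolicy π) {g : Fn S A H} (hg : ∀ s a h, g s a h ∈ Set.Icc (0 : ℝ) 1)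
    {P Q : Ker S A H} (hP : P ∈ confSet K δ w) (hQ : Q ∈ confSet K δ w) :
    value p π g P ≤ value p π (fun s a h => g s a h + bonusU K δ w s a h) Q := by
  have hL0 : 0 ≤ logTerm S A H K δ := zero_le_one.trans hL
  set ℓ : Fn S A H := fun s a h => g s a h - 1 / 2 with hℓ_def
  have hℓ (s a h) : |ℓ s a h| ≤ 1 / 2 :=
    abs_le.2 ⟨by simp only [hℓ_def]; linarith [(hg s a h).1],
      by simp only [hℓ_def]; linarith [(hg s a h).2]⟩
  have h_shift {R : Ker S A H} (hR : IsKernel R) :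
      value p π ℓ R = value p π g R - H * (1 / 2) := by
    rw [hℓ_def, value_sub p π _ g fun _ _ _ => 1 / 2, value_const hp1 hπ hR]
  obtain ⟨θ, hθ, hθH, hθ_le⟩ := exists_tilt_le_pessimism (H := H) (S := Fintype.card S)
    (A := Fintype.card A) (K := K) (by positivity) (by positivity) (by positivity)
    (by positivity) hL0
  have h_error : value p π (modelError π ℓ P Q) Q ≤ value p π (bonusU K δ w) Q :=
    calc value p π (modelError π ℓ P Q) Q
        ≤ value p π (fun s a h => |modelError π ℓ P Q s a h|) Q :=
          value_mono hp hπ hQ.1 fun s a h => le_abs_self _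
      _ ≤ value p π (fun s a h => θ * H + (8 / θ + 46 * H) * Fintype.card S
            * √(logTerm S A H K δ / den w s a h) ^ 2) Q :=
          value_abs_modelError_le hp hp1 hπ hP.1 hQ.1 hℓ (abs_sub_le_of_mem_confSet hL0 hP hQ)
            hθ hθH
      _ ≤ value p π (bonusU K δ w) Q := value_mono hp hπ hQ.1 fun s a h => by
          have hD := den_pos w s a h
          rw [Real.sq_sqrt (div_nonneg hL0 hD.le)]
          exact (hθ_le _ hD).trans (le_bonusU hH hL w s a h)
  have h_sim := value_sub_value (p := p) (ℓ := ℓ) hπ hP.1 hQ.1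
  rw [h_shift hP.1, h_shift hQ.1] at h_sim
  rw [value_add]
  linarith

end Pessimism

open scoped ENNReal

section PathProd

variable {α : Type*}

/-- The product along the sequence `w` of factors `G` that may depend on the past: the exponential
supermartingales of the concentration argument are of this form. -/
noncomputable def pathProd (G : (k : ℕ) → (Fin k → α) → α → ℝ≥0∞) {k : ℕ} (w : Fin k → α) : ℝ≥0∞ :=
  ∏ j : Fin k, G j (Fin.take j j.isLt.le w) (w j)

lemma pathProd_succ (G : (k : ℕ) → (Fin k → α) → α → ℝ≥0∞) {k : ℕ} (w : Fin (k + 1) → α) :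
    pathProd G w = pathProd G (Fin.init w) * G k (Fin.init w) (w (Fin.last k)) :=
  Fin.prod_univ_castSucc _

variable [MeasurableSpace α]

lemma measurable_snoc {k : ℕ} :
    Measurable fun x : (Fin k → α) × α => (Fin.snoc x.1 x.2 : Fin (k + 1) → α) := by
  refine measurable_pi_lambda _ fun i => ?_
  cases i using Fin.lastCases with
  | last => simpa only [Fin.snoc_last] using measurable_snd
  | cast i =>
    simp only [Fin.snoc_castSucc]
    exact (measurable_pi_apply i).comp measurable_fst

lemma measurable_snoc_left {k : ℕ} (w : Fin k → α) :
    Measurable fun a : α => (Fin.snoc w a : Fin (k + 1) → α) :=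
  measurable_snoc.comp measurable_prodMk_left

lemma measurable_pathProd {G : (k : ℕ) → (Fin k → α) → α → ℝ≥0∞}
    (hG : ∀ k, Measurable fun x : (Fin k → α) × α => G k x.1 x.2) (k : ℕ) :
    Measurable fun w : Fin k → α => pathProd G w := by
  refine Finset.measurable_prod _ fun j _ => ?_
  have h_take : Measurable fun w : Fin k → α => Fin.take j j.isLt.le w :=
    measurable_pi_lambda _ fun _ => measurable_pi_apply _
  exact (hG j).comp (h_take.prodMk (measurable_pi_apply j))

end PathProd

section Traj

variable {S A : Type*} [Fintype S] [Fintype A] [MeasurableSpace S] [MeasurableSpace A] {H : ℕ}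

lemma isProbabilityMeasure_trajLaw (M : CMDP S A H) {π : Pol S A H} (hπ : IsPolicy π) :
    IsProbabilityMeasure (trajLaw M π) := by
  refine ⟨?_⟩
  have h_one := trajMean_const M.init_sum hπ M.trans_isKernel 1
  simp only [trajMean, mul_one] at h_one
  simp [trajLaw, ← ENNReal.ofReal_sum_of_nonneg fun τ _ =>
    trajProb_nonneg M.init_nonneg hπ M.trans_isKernel τ, h_one]

lemma measurable_trajProb_policy (M : CMDP S A H) (L : Learner S A H) (k : ℕ) (τ : Traj S A H) :
    Measurable fun w => trajProb M.init (L.policy k w) M.trans τ := by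
  have hπ (s h a) : Measurable fun w => L.policy k w s h a :=
    (measurable_pi_apply a).comp ((measurable_pi_apply h).comp
      ((measurable_pi_apply s).comp (L.policy_measurable k)))
  unfold trajProb
  exact (Finset.measurable_prod _ fun h _ => (hπ _ _ _).mul_const _).const_mul _

end Traj

section RunLaw

variable {S A : Type*} [Fintype S] [Fintype A]
  [MeasurableSpace S] [DiscreteMeasurableSpace S] [MeasurableSpace A]
  [DiscreteMeasurableSpace A] {H : ℕ}

lemma measurable_observe (M : CMDP S A H) : Measurable (observe M) := by
  refine measurable_from_prod_countable_right fun τ => ?_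
  refine measurable_const.prodMk (Measurable.prodMk ?_ ?_) <;>
    refine measurable_pi_lambda _ fun h => ?_ <;> dsimp only <;> refine Measurable.const_add ?_ _
  · exact (measurable_pi_apply (τ.1 h.castSucc, τ.2 h, h)).comp measurable_fst
  · exact (measurable_pi_apply (τ.1 h.castSucc, τ.2 h, h)).comp measurable_snd

section Episode

variable (M : CMDP S A H) (νf νg : S × A × Fin H → Measure ℝ)
  [∀ i, IsProbabilityMeasure (νf i)] [∀ i, IsProbabilityMeasure (νg i)]

lemma lintegral_episodeLaw (π : Pol S A H) {F : Episode S A H → ℝ≥0∞} (hF : Measurable F) :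
    ∫⁻ e, F e ∂episodeLaw M νf νg π
      = ∑ τ : Traj S A H, ENNReal.ofReal (trajProb M.init π M.trans τ)
        * ∫⁻ z, F (observe M (τ, z)) ∂((Measure.pi νf).prod (Measure.pi νg)) := by
  have h_comp : Measurable fun x => F (observe M x) := hF.comp (measurable_observe M)
  rw [episodeLaw, lintegral_map hF (measurable_observe M),
    lintegral_prod _ h_comp.aemeasurable, trajLaw,
    lintegral_finsetSum_measure]
  refine Finset.sum_congr rfl fun τ _ => ?_
  rw [lintegral_smul_measure, lintegral_dirac]
  rfl

lemma lintegral_episodeLaw_le {π : Pol S A H} (hπ : IsPolicy π) {F : Episode S A H → ℝ≥0∞}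
    (hF : Measurable F) {Φ : Traj S A H → ℝ}
    (hFΦ : ∀ τ, ∫⁻ z, F (observe M (τ, z)) ∂((Measure.pi νf).prod (Measure.pi νg))
      ≤ ENNReal.ofReal (Φ τ)) (hΦ : ∀ τ, 0 ≤ Φ τ) :
    ∫⁻ e, F e ∂episodeLaw M νf νg π ≤ ENNReal.ofReal (trajMean M.init π M.trans Φ) := by
  have h_prob := trajProb_nonneg M.init_nonneg hπ M.trans_isKernel
  rw [lintegral_episodeLaw M νf νg π hF, trajMean,
    ENNReal.ofReal_sum_of_nonneg fun τ _ => mul_nonneg (h_prob τ) (hΦ τ)]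
  refine Finset.sum_le_sum fun τ _ => ?_
  rw [ENNReal.ofReal_mul (h_prob τ)]
  exact mul_le_mul_right (hFΦ τ) _

lemma isProbabilityMeasure_episodeLaw {π : Pol S A H} (hπ : IsPolicy π) :
    IsProbabilityMeasure (episodeLaw M νf νg π) :=
  have := isProbabilityMeasure_trajLaw M hπ
  Measure.isProbabilityMeasure_map (measurable_observe M).aemeasurable

end Episode

variable (M : CMDP S A H) (νf νg : ℕ → S × A × Fin H → Measure ℝ)
  [∀ k i, IsProbabilityMeasure (νf k i)] [∀ k i, IsProbabilityMeasure (νg k i)]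
  (L : Learner S A H)

lemma measurable_map_snoc_episodeLaw (k : ℕ) : Measurable fun w : Hist S A H k =>
    (episodeLaw M (νf k) (νg k) (L.policy k w)).map fun e =>
      (Fin.snoc w e : Hist S A H (k + 1)) := by
  refine Measure.measurable_of_measurable_coe _ fun s hs => ?_
  have h_ind : Measurable (s.indicator (1 : Hist S A H (k + 1) → ℝ≥0∞)) :=
    measurable_one.indicator hs
  have h_eq (w : Hist S A H k) : (episodeLaw M (νf k) (νg k) (L.policy k w)).map
      (fun e => (Fin.snoc w e : Hist S A H (k + 1))) s
      = ∑ τ : Traj S A H, ENNReal.ofReal (trajProb M.init (L.policy k w) M.trans τ)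
        * ∫⁻ z, s.indicator 1 (Fin.snoc w (observe M (τ, z)) : Hist S A H (k + 1))
          ∂((Measure.pi (νf k)).prod (Measure.pi (νg k))) := by
    rw [← lintegral_indicator_one hs, lintegral_map h_ind (measurable_snoc_left w)]
    exact lintegral_episodeLaw M (νf k) (νg k) _ (h_ind.comp (measurable_snoc_left w))
  simp_rw [h_eq]
  refine Finset.measurable_sum _ fun τ _ =>
    (measurable_trajProb_policy M L k τ).ennreal_ofReal.mul ?_
  refine Measurable.lintegral_prod_right' (f := fun x : Hist S A H k × _ =>
    s.indicator 1 (Fin.snoc x.1 (observe M (τ, x.2)) : Hist S A H (k + 1))) ?_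
  exact h_ind.comp (measurable_snoc.comp (measurable_fst.prodMk
    ((measurable_observe M).comp (measurable_const.prodMk measurable_snd))))

lemma lintegral_runLaw_succ (k : ℕ) {F : Hist S A H (k + 1) → ℝ≥0∞} (hF : Measurable F) :
    ∫⁻ w, F w ∂runLaw M νf νg L (k + 1)
      = ∫⁻ w, ∫⁻ e, F (Fin.snoc w e : Hist S A H (k + 1))
          ∂episodeLaw M (νf k) (νg k) (L.policy k w) ∂runLaw M νf νg L k := by
  rw [runLaw, Measure.lintegral_bind (measurable_map_snoc_episodeLaw M νf νg L k).aemeasurable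
    hF.aemeasurable]
  exact lintegral_congr fun w => lintegral_map hF (measurable_snoc_left w)

instance isProbabilityMeasure_runLaw (k : ℕ) : IsProbabilityMeasure (runLaw M νf νg L k) := by
  refine ⟨?_⟩
  induction k with
  | zero => simp [runLaw]
  | succ k ih =>
    have h_episode (w) := isProbabilityMeasure_episodeLaw M (νf k) (νg k) (L.policy_isPolicy k w)
    rw [← lintegral_one, lintegral_runLaw_succ M νf νg L k measurable_const]
    simp only [lintegral_one, measure_univ, ih]

lemma lintegral_pathProd_le_one {G : (k : ℕ) → Hist S A H k → Episode S A H → ℝ≥0∞}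
    (hG : ∀ k, Measurable fun x : Hist S A H k × Episode S A H => G k x.1 x.2)
    (hG1 : ∀ k w, ∫⁻ e, G k w e ∂episodeLaw M (νf k) (νg k) (L.policy k w) ≤ 1) (k : ℕ) :
    ∫⁻ w, pathProd G w ∂runLaw M νf νg L k ≤ 1 := by
  induction k with
  | zero => simp [runLaw, pathProd]
  | succ k ih =>
    rw [lintegral_runLaw_succ M νf νg L k (measurable_pathProd hG _)]
    refine le_trans (lintegral_mono fun w => ?_) ih
    simp only [pathProd_succ, Fin.init_snoc, Fin.snoc_last]
    have h_meas : Measurable (G k w) := (hG k).comp measurable_prodMk_left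
    rw [lintegral_const_mul _ h_meas]
    exact mul_le_of_le_one_right zero_le (hG1 k w)

end RunLaw

section Visits

variable {S A : Type*} [DecidableEq S] [DecidableEq A] {H : ℕ}

lemma visit_le_one (e : Episode S A H) (s : S) (a : A) (h : Fin H) : visit e s a h ≤ 1 := by
  unfold visit
  split_ifs <;> simp

lemma countN_succ {k : ℕ} (w : Hist S A H (k + 1)) (s : S) (a : A) (h : Fin H) :
    countN w s a h = countN (Fin.init w : Hist S A H k) s a h + visit (w (Fin.last k)) s a h :=
  Fin.sum_univ_castSucc _

lemma countN_take_mono {K : ℕ} (ω : Hist S A H K) (s : S) (a : A) (h : Fin H) {k m : ℕ}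
    (hkm : k ≤ m) (hm : m ≤ K) :
    countN (Fin.take k (hkm.trans hm) ω) s a h ≤ countN (Fin.take m hm ω) s a h := by
  induction m, hkm using Nat.le_induction with
  | base => exact le_rfl
  | succ m hkm ih =>
    rw [countN_succ]
    exact (ih (by omega)).trans (Nat.le_add_right _ _)

lemma countN_le {k : ℕ} (w : Hist S A H k) (s : S) (a : A) (h : Fin H) : countN w s a h ≤ k := by
  simpa [countN] using Finset.sum_le_card_nsmul Finset.univ _ 1 fun j _ => visit_le_one (w j) s a h

/-- The sum of the statistic `x` over the recorded visits to `(s, a, h)`. -/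
noncomputable def visitSum (s : S) (a : A) (h : Fin H) (x : Episode S A H → ℝ) {k : ℕ}
    (w : Hist S A H k) : ℝ :=
  ∑ j, visit (w j) s a h * x (w j)

/-- The factor `exp (x e)` of an episode `e` that is one of the first `n` visits to `(s, a, h)`. -/
noncomputable def visitFactor (s : S) (a : A) (h : Fin H) (n : ℕ) (x : Episode S A H → ℝ) (k : ℕ)
    (w : Hist S A H k) (e : Episode S A H) : ℝ≥0∞ :=
  if countN w s a h < n then ENNReal.ofReal (Real.exp (visit e s a h * x e)) else 1

lemma visitSum_succ (s : S) (a : A) (h : Fin H) (x : Episode S A H → ℝ) {k : ℕ}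
    (w : Hist S A H (k + 1)) :
    visitSum s a h x w = visitSum s a h x (Fin.init w : Hist S A H k)
      + visit (w (Fin.last k)) s a h * x (w (Fin.last k)) :=
  Fin.sum_univ_castSucc _

lemma pathProd_visitFactor_of_countN_le (s : S) (a : A) (h : Fin H) {n : ℕ}
    (x : Episode S A H → ℝ) {k : ℕ} {w : Hist S A H k} (hw : countN w s a h ≤ n) :
    pathProd (visitFactor s a h n x) w = ENNReal.ofReal (Real.exp (visitSum s a h x w)) := by
  induction k with
  | zero => simp [pathProd, visitSum]
  | succ k ih =>
    rw [countN_succ] at hw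
    rw [pathProd_succ, ih ((Nat.le_add_right _ _).trans hw), visitSum_succ,
      Real.exp_add, ENNReal.ofReal_mul (Real.exp_nonneg _)]
    congr 1
    rcases Nat.le_one_iff_eq_zero_or_eq_one.1 (visit_le_one (w (Fin.last k)) s a h) with h0 | h1
    · simp [visitFactor, h0]
    · rw [visitFactor, if_pos (by omega)]

lemma pathProd_visitFactor_take {K : ℕ} (ω : Hist S A H K) (s : S) (a : A) (h : Fin H) {n : ℕ}
    (x : Episode S A H → ℝ) {k m : ℕ} (hkm : k ≤ m) (hm : m ≤ K)
    (hn : n ≤ countN (Fin.take k (hkm.trans hm) ω) s a h) :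
    pathProd (visitFactor s a h n x) (Fin.take m hm ω)
      = pathProd (visitFactor s a h n x) (Fin.take k (hkm.trans hm) ω) := by
  induction m, hkm using Nat.le_induction with
  | base => rfl
  | succ m hkm ih =>
    have h_frozen : ¬ countN (Fin.take m (by omega) ω) s a h < n :=
      (hn.trans (countN_take_mono ω s a h hkm (by omega))).not_gt
    have h_init : (Fin.init (Fin.take (m + 1) hm ω) : Hist S A H m) = Fin.take m (by omega) ω := rfl
    rw [pathProd_succ, h_init, ih (by omega) hn, visitFactor, if_neg h_frozen, mul_one]

end Visits

section Measurability

variable {S A : Type*} [Finite S] [Finite A] [DecidableEq S] [DecidableEq A] [MeasurableSpace S]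
  [DiscreteMeasurableSpace S] [MeasurableSpace A] [DiscreteMeasurableSpace A] {H : ℕ}

lemma measurable_visit (s : S) (a : A) (h : Fin H) :
    Measurable fun e : Episode S A H => visit e s a h :=
  (Measurable.of_discrete (f := fun τ : Traj S A H =>
    if τ.1 h.castSucc = s ∧ τ.2 h = a then 1 else 0)).comp measurable_fst

lemma measurable_countN (k : ℕ) (s : S) (a : A) (h : Fin H) :
    Measurable fun w : Hist S A H k => countN w s a h :=
  Finset.measurable_sum _ fun j _ => (measurable_visit s a h).comp (measurable_pi_apply j)

lemma measurable_ofReal_exp_visit_mul (s : S) (a : A) (h : Fin H) {x : Episode S A H → ℝ}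
    (hx : Measurable x) :
    Measurable fun e => ENNReal.ofReal (Real.exp (visit e s a h * x e)) :=
  ((measurable_from_nat.comp (measurable_visit s a h)).mul hx).exp.ennreal_ofReal

lemma measurable_visitFactor (s : S) (a : A) (h : Fin H) (n : ℕ) {x : Episode S A H → ℝ}
    (hx : Measurable x) (k : ℕ) :
    Measurable fun p : Hist S A H k × Episode S A H => visitFactor s a h n x k p.1 p.2 :=
  Measurable.ite (((measurable_countN k s a h).comp measurable_fst) measurableSet_Iio)
    ((measurable_ofReal_exp_visit_mul s a h hx).comp measurable_snd) measurable_const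

end Measurability

section Tail

variable {S A : Type*} [Fintype S] [Fintype A] [DecidableEq S] [DecidableEq A] [MeasurableSpace S]
  [DiscreteMeasurableSpace S] [MeasurableSpace A] [DiscreteMeasurableSpace A] {H : ℕ}

variable (M : CMDP S A H) (νf νg : ℕ → S × A × Fin H → Measure ℝ)
  [∀ k i, IsProbabilityMeasure (νf k i)] [∀ k i, IsProbabilityMeasure (νg k i)]
  (L : Learner S A H) (s : S) (a : A) (h : Fin H)

/-- `x` is the increment of an exponential supermartingale along the visits to `(s, a, h)`,
whatever policies are played. -/
def IsVisitExponent (x : Episode S A H → ℝ) : Prop :=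
  Measurable x ∧ ∀ k π, IsPolicy π →
    ∫⁻ e, ENNReal.ofReal (Real.exp (visit e s a h * x e)) ∂episodeLaw M (νf k) (νg k) π ≤ 1

variable {M νf νg s a h}

-- The product over the first `n` visits is a supermartingale along the whole run, and it no longer
-- changes after the `n`-th visit: no stopping time is needed to evaluate it there.
lemma runLaw_exists_countN_eq_le {x : Episode S A H → ℝ} (hx : IsVisitExponent M νf νg s a h x)
    (K n : ℕ) (c : ℝ) :
    runLaw M νf νg L K {ω | ∃ k : Fin K, countN (Fin.take k k.isLt.le ω) s a h = n ∧
      c ≤ visitSum s a h x (Fin.take k k.isLt.le ω)} ≤ ENNReal.ofReal (Real.exp (-c)) := by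
  have h_meas := measurable_visitFactor s a h n hx.1
  have h_factor (k w) :
      ∫⁻ e, visitFactor s a h n x k w e ∂episodeLaw M (νf k) (νg k) (L.policy k w) ≤ 1 := by
    have := isProbabilityMeasure_episodeLaw M (νf k) (νg k) (L.policy_isPolicy k w)
    by_cases hw : countN w s a h < n
    · simpa [visitFactor, hw] using hx.2 k _ (L.policy_isPolicy k w)
    · simp [visitFactor, hw]
  have h_markov := meas_ge_le_lintegral_div (μ := runLaw M νf νg L K)
    (measurable_pathProd h_meas K).aemeasurable (ENNReal.ofReal_pos.2 (Real.exp_pos c)).ne'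
    ENNReal.ofReal_ne_top
  refine (measure_mono ?_).trans (h_markov.trans ?_)
  · rintro ω ⟨k, hn, hc⟩
    have h_take := pathProd_visitFactor_take ω s a h x k.isLt.le le_rfl hn.ge
    rw [pathProd_visitFactor_of_countN_le s a h x hn.le] at h_take
    exact (ENNReal.ofReal_le_ofReal (Real.exp_le_exp.2 hc)).trans_eq h_take.symm
  · rw [Real.exp_neg, ENNReal.ofReal_inv_of_pos (Real.exp_pos c), ENNReal.div_eq_inv_mul]
    exact mul_le_of_le_one_right zero_le (lintegral_pathProd_le_one M νf νg L h_meas h_factor K)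

lemma runLaw_exists_le_visitSum_le {x : ℕ → Episode S A H → ℝ}
    (hx : ∀ n, IsVisitExponent M νf νg s a h (x n)) (K : ℕ) (c : ℝ) :
    runLaw M νf νg L K {ω | ∃ k : Fin K,
      c ≤ visitSum s a h (x (countN (Fin.take k k.isLt.le ω) s a h)) (Fin.take k k.isLt.le ω)}
      ≤ K * ENNReal.ofReal (Real.exp (-c)) := by
  calc _ ≤ runLaw M νf νg L K (⋃ n : Fin K, {ω | ∃ k : Fin K,
        countN (Fin.take k k.isLt.le ω) s a h = n ∧
          c ≤ visitSum s a h (x n) (Fin.take k k.isLt.le ω)}) := by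
        refine measure_mono ?_
        rintro ω ⟨k, hk⟩
        exact Set.mem_iUnion.2 ⟨⟨_, (countN_le _ s a h).trans_lt k.isLt⟩, k, rfl, hk⟩
    _ ≤ ∑ _n : Fin K, ENNReal.ofReal (Real.exp (-c)) :=
        (measure_iUnion_fintype_le _ _).trans
          (Finset.sum_le_sum fun n _ => runLaw_exists_countN_eq_le L (hx n) K n c)
    _ = K * ENNReal.ofReal (Real.exp (-c)) := by simp

end Tail

section Tilt

lemma one_sub_mul_exp_le {z : ℝ} (h0 : 0 ≤ z) (h1 : z ≤ 1) :
    (1 - z) * Real.exp z ≤ 1 - z ^ 2 / 2 := by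
  have h_exp := Real.exp_bound' h0 h1 (n := 3) (by norm_num)
  norm_num [Finset.sum_range_succ, Nat.factorial] at h_exp
  calc (1 - z) * Real.exp z ≤ (1 - z) * (1 + z + z ^ 2 / 2 + z ^ 3 * 4 / 18) :=
        mul_le_mul_of_nonneg_left h_exp (by linarith)
    _ ≤ 1 - z ^ 2 / 2 := by nlinarith [pow_nonneg h0 3, pow_nonneg h0 4]

lemma exp_neg_le_quadratic {z : ℝ} (h0 : 0 ≤ z) : Real.exp (-z) ≤ 1 - z + z ^ 2 / 2 := by
  have h_pos : 0 < 1 + z + z ^ 2 / 2 := by positivity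
  rw [Real.exp_neg]
  calc (Real.exp z)⁻¹ ≤ (1 + z + z ^ 2 / 2)⁻¹ :=
        inv_anti₀ h_pos (Real.quadratic_le_exp_of_nonneg h0)
    _ ≤ 1 - z + z ^ 2 / 2 := by
        rw [inv_le_iff_one_le_mul₀ h_pos]
        nlinarith [sq_nonneg (z ^ 2)]

lemma exists_tilt_of_add_two_mul_sqrt_lt {p c : ℝ} (hp : 0 ≤ p) (hc : 0 ≤ c) :
    ∃ t : ℝ, ∀ x, p + 2 * √(x * c) < x → 2 * c ≤ t * x - p * (Real.exp t - 1) := by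
  have hr := Real.sqrt_nonneg c
  have hr_sq := Real.sq_sqrt hc
  have hq := Real.sq_sqrt (add_nonneg hp hc)
  have hrq : √c ≤ √(p + c) := Real.sqrt_le_sqrt (by linarith)
  set r := √c
  -- `y ^ 2` is the point `x` at which `p + 2 √(x c) = x`.
  set y := r + √(p + c) with hy
  set t := 2 * r / y
  have hy0 : 0 ≤ y := by positivity
  have hty : t * y = 2 * r := div_mul_cancel_of_imp fun hy_zero => by linarith
  have ht0 : 0 ≤ t := by positivity
  have ht1 : t ≤ 1 := div_le_one_of_le₀ (by linarith) hy0
  have hpy : p = y ^ 2 * (1 - t) := by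
    calc p = y ^ 2 - y * (2 * r) := by rw [hy]; linarith
      _ = y ^ 2 * (1 - t) := by rw [← hty]; ring
  have h_base : 2 * c ≤ t * y ^ 2 - p * (Real.exp t - 1) := by
    calc 2 * c = y ^ 2 * (t ^ 2 / 2) := by
          rw [← hr_sq]; linear_combination (-(t * y + 2 * r) / 2) * hty
      _ ≤ y ^ 2 * (1 - (1 - t) * Real.exp t) := by
          gcongr
          linarith [one_sub_mul_exp_le ht0 ht1]
      _ = t * y ^ 2 - p * (Real.exp t - 1) := by rw [hpy]; ring
  refine ⟨t, fun x hx => h_base.trans ?_⟩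
  have hx0 : 0 ≤ x := by linarith [Real.sqrt_nonneg (x * c)]
  have hyx : y ≤ √x := by
    rw [Real.sqrt_mul hx0] at hx
    have hx_sq := Real.sq_sqrt hx0
    by_contra! hlt
    nlinarith [Real.sqrt_nonneg x]
  gcongr
  exact (Real.le_sqrt hy0 hx0).1 hyx

lemma exists_tilt_of_lt_sub_two_mul_sqrt (p : ℝ) {c : ℝ} (hc : 0 ≤ c) :
    ∃ t : ℝ, ∀ x, 0 ≤ x → x + 2 * √(x * c) + 4 * c < p →
      2 * c ≤ t * x - p * (Real.exp t - 1) := by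
  refine ⟨-(2 * √c / √p), fun x hx0 hx => ?_⟩
  rw [Real.sqrt_mul hx0] at hx
  have hp : 0 < p := lt_of_le_of_lt (by positivity) hx
  have hx_sq := Real.sq_sqrt hx0
  have hc_sq := Real.sq_sqrt hc
  have hp_sq := Real.sq_sqrt hp.le
  have hs := Real.sqrt_pos.2 hp
  have hz := Real.sqrt_nonneg x
  have hr := Real.sqrt_nonneg c
  set z := √x
  set r := √c
  set s := √p
  set t := 2 * r / s
  have hts : t * s = 2 * r := div_mul_cancel₀ _ hs.ne'
  have h_gap : 2 * r * s ≤ s ^ 2 - z ^ 2 := by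
    rcases le_or_gt (z + 2 * r) s with h_le | h_lt <;> nlinarith
  have h_exp := exp_neg_le_quadratic (show 0 ≤ t by positivity)
  calc 2 * c = 2 * r * (2 * r) - s ^ 2 * (t ^ 2 / 2) := by
        rw [← hc_sq]; linear_combination (t * s + 2 * r) / 2 * hts
    _ ≤ t * (s ^ 2 - z ^ 2) - s ^ 2 * (t ^ 2 / 2) := by
        have := mul_le_mul_of_nonneg_left h_gap (show 0 ≤ t by positivity)
        linear_combination this - 2 * r * hts
    _ = -t * x + p * (1 - (1 - t + t ^ 2 / 2)) := by rw [hp_sq, hx_sq]; ring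
    _ ≤ -t * x - p * (Real.exp (-t) - 1) := by
        have := mul_le_mul_of_nonneg_left h_exp hp.le
        linarith

end Tilt

section Statistics

lemma sum_mul_exp_indicator_sub_le_one {ι : Type*} [Fintype ι] [DecidableEq ι] {q : ι → ℝ}
    (hq : ∑ i, q i = 1) (j : ι) (t : ℝ) :
    ∑ i, q i * Real.exp (t * (if i = j then 1 else 0) - q j * (Real.exp t - 1)) ≤ 1 := by
  set b := q j * (Real.exp t - 1)
  have h_term (i) : q i * Real.exp (t * (if i = j then 1 else 0) - b)
      = (q i + if i = j then b else 0) * Real.exp (-b) := by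
    rw [sub_eq_add_neg, Real.exp_add]
    split_ifs with hi
    · rw [hi, mul_one]
      ring
    · rw [mul_zero, Real.exp_zero]
      ring
  calc ∑ i, q i * Real.exp (t * (if i = j then 1 else 0) - b)
      = (b + 1) * Real.exp (-b) := by
        simp_rw [h_term, ← Finset.sum_mul, Finset.sum_add_distrib, hq, Finset.sum_ite_eq',
          Finset.mem_univ, if_true, add_comm]
    _ ≤ Real.exp b * Real.exp (-b) := by
        gcongr
        exact Real.add_one_le_exp b
    _ = 1 := by rw [← Real.exp_add, add_neg_cancel, Real.exp_zero]

lemma lintegral_exp_mul_sub_le_one {ν : Measure ℝ} (hν : IsNoise ν) (t : ℝ) :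
    ∫⁻ y, ENNReal.ofReal (Real.exp (t * y - t ^ 2 / 4)) ∂ν ≤ 1 := by
  obtain ⟨_, -, h_subgaussian⟩ := hν
  have h_split (y : ℝ) :
      Real.exp (t * y - t ^ 2 / 4) = Real.exp (t * y) * Real.exp (-(t ^ 2 / 4)) := by
    rw [sub_eq_add_neg, Real.exp_add]
  have h_mgf : ∫ y, Real.exp (t * y) ∂ν ≤ Real.exp (t ^ 2 / 4) := by
    refine (h_subgaussian.mgf_le t).trans_eq ?_
    push_cast
    ring_nf
  simp_rw [h_split]
  rw [← ofReal_integral_eq_lintegral_ofReal ((h_subgaussian.integrable_exp_mul t).mul_const _)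
    (Filter.Eventually.of_forall fun y => by positivity), integral_mul_const,
    ENNReal.ofReal_le_one]
  calc (∫ y, Real.exp (t * y) ∂ν) * Real.exp (-(t ^ 2 / 4))
      ≤ Real.exp (t ^ 2 / 4) * Real.exp (-(t ^ 2 / 4)) := by gcongr
    _ = 1 := by rw [← Real.exp_add, add_neg_cancel, Real.exp_zero]

variable {S A : Type*} [Fintype S] [Fintype A] {H : ℕ}

/-- The log-weight, at tilt `t`, of the cost observed at a visit to `(s, a, h)`. -/
noncomputable def costStat (M : CMDP S A H) (s : S) (a : A) (h : Fin H) (t : ℝ)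
    (e : Episode S A H) : ℝ :=
  t * (e.2.2 h - M.cost s a h) - t ^ 2 / 4

lemma measurable_costStat [MeasurableSpace S] [MeasurableSpace A] (M : CMDP S A H) (s : S) (a : A)
    (h : Fin H) (t : ℝ) : Measurable (costStat M s a h t) := by
  have h_obs : Measurable fun e : Episode S A H => e.2.2 h :=
    (measurable_pi_apply h).comp (measurable_snd.comp measurable_snd)
  exact ((h_obs.sub_const _).const_mul t).sub_const _

variable [DecidableEq S]

/-- The log-weight, at tilt `t`, of the event that a visit to `(s, a, h)` is followed by `s'`. The
Bernoulli log-moment is replaced by its Poisson upper bound. -/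
noncomputable def transStat (M : CMDP S A H) (s : S) (a : A) (h : Fin H) (s' : S) (t : ℝ)
    (e : Episode S A H) : ℝ :=
  t * (if e.1.1 h.succ = s' then 1 else 0) - M.trans s a h s' * (Real.exp t - 1)

lemma measurable_transStat [MeasurableSpace S] [DiscreteMeasurableSpace S] [MeasurableSpace A]
    [DiscreteMeasurableSpace A] (M : CMDP S A H) (s : S) (a : A) (h : Fin H) (s' : S) (t : ℝ) :
    Measurable (transStat M s a h s' t) :=
  (Measurable.of_discrete (f := fun τ : Traj S A H =>
    t * (if τ.1 h.succ = s' then 1 else 0) - M.trans s a h s' * (Real.exp t - 1))).comp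
      measurable_fst

variable [DecidableEq A]

lemma visitSum_costStat (M : CMDP S A H) (s : S) (a : A) (h : Fin H) (t : ℝ) {k : ℕ}
    (w : Hist S A H k) :
    visitSum s a h (costStat M s a h t) w
      = t * (∑ j, (w j).2.2 h * (visit (w j) s a h : ℝ) - countN w s a h * M.cost s a h)
        - countN w s a h * (t ^ 2 / 4) := by
  simp only [visitSum, costStat, countN, Nat.cast_sum, Finset.sum_mul, Finset.mul_sum,
    ← Finset.sum_sub_distrib]
  exact Finset.sum_congr rfl fun j _ => by ring

lemma visitSum_transStat (M : CMDP S A H) (s : S) (a : A) (h : Fin H) (s' : S) (t : ℝ) {k : ℕ}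
    (w : Hist S A H k) :
    visitSum s a h (transStat M s a h s' t) w
      = t * countM w s a s' h - countN w s a h * (M.trans s a h s' * (Real.exp t - 1)) := by
  simp only [visitSum, transStat, countN, countM, Nat.cast_sum, Finset.sum_mul, Finset.mul_sum,
    ← Finset.sum_sub_distrib]
  refine Finset.sum_congr rfl fun j _ => ?_
  split_ifs <;> push_cast <;> ring

variable [MeasurableSpace S] [DiscreteMeasurableSpace S] [MeasurableSpace A]
  [DiscreteMeasurableSpace A] {M : CMDP S A H} {νf νg : ℕ → S × A × Fin H → Measure ℝ}
  [∀ k i, IsProbabilityMeasure (νf k i)]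

lemma isVisitExponent_of_sum_mul_le_one [∀ k i, IsProbabilityMeasure (νg k i)] {s : S} {a : A}
    {h : Fin H} {x : Episode S A H → ℝ} (hx : Measurable x) {φ : S → ℝ} (hφ : ∀ s', 0 ≤ φ s')
    (hφ1 : ∑ s', M.trans s a h s' * φ s' ≤ 1)
    (h_noise : ∀ k, ∀ τ : Traj S A H, τ.1 h.castSucc = s → τ.2 h = a →
      ∫⁻ z, ENNReal.ofReal (Real.exp (x (observe M (τ, z))))
        ∂((Measure.pi (νf k)).prod (Measure.pi (νg k))) ≤ ENNReal.ofReal (φ (τ.1 h.succ))) :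
    IsVisitExponent M νf νg s a h x := by
  refine ⟨hx, fun k π hπ => ?_⟩
  set F : S → A → S → ℝ := fun s₀ a₀ s₁ => if s₀ = s ∧ a₀ = a then φ s₁ else 1 with hF
  have hP := M.trans_isKernel
  have h_mean (s₀ a₀) : ∑ s₁, M.trans s₀ a₀ h s₁ * F s₀ a₀ s₁ ≤ 1 := by
    by_cases hv : s₀ = s ∧ a₀ = a
    · simpa only [hF, hv.1, hv.2, and_self, if_true] using hφ1
    · simp only [hF, if_neg hv, mul_one, (hP s₀ a₀ h).2, le_refl]
  calc ∫⁻ e, ENNReal.ofReal (Real.exp (visit e s a h * x e)) ∂episodeLaw M (νf k) (νg k) π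
      ≤ ENNReal.ofReal (trajMean M.init π M.trans
          fun τ => F (τ.1 h.castSucc) (τ.2 h) (τ.1 h.succ)) := by
        refine lintegral_episodeLaw_le M (νf k) (νg k) hπ
          (measurable_ofReal_exp_visit_mul s a h hx) (fun τ => ?_) fun τ => ?_
        · by_cases hv : τ.1 h.castSucc = s ∧ τ.2 h = a
          · simpa [hF, visit, observe, hv] using h_noise k τ hv.1 hv.2
          · simp [hF, visit, observe, hv]
        · simp only [hF]
          split_ifs
          exacts [hφ _, zero_le_one]
    _ ≤ ENNReal.ofReal (trajMean M.init π M.trans fun _ => 1) := by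
        rw [trajMean_next hπ hP]
        exact ENNReal.ofReal_le_ofReal (trajMean_mono M.init_nonneg hπ hP fun τ => h_mean _ _)
    _ = 1 := by rw [trajMean_const M.init_sum hπ hP, ENNReal.ofReal_one]

lemma isVisitExponent_costStat (hνg : ∀ k i, IsNoise (νg k i)) (s : S) (a : A) (h : Fin H)
    (t : ℝ) : IsVisitExponent M νf νg s a h (costStat M s a h t) := by
  have := fun k i => (hνg k i).1
  refine isVisitExponent_of_sum_mul_le_one (measurable_costStat M s a h t) (φ := fun _ => 1)
    (fun _ => zero_le_one) (by simp only [mul_one, (M.trans_isKernel s a h).2, le_refl]) ?_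
  rintro k τ rfl rfl
  have h_eval : MeasurePreserving (fun z : (S × A × Fin H → ℝ) × (S × A × Fin H → ℝ) =>
      z.2 (τ.1 h.castSucc, τ.2 h, h)) ((Measure.pi (νf k)).prod (Measure.pi (νg k)))
      (νg k (τ.1 h.castSucc, τ.2 h, h)) :=
    (measurePreserving_eval (νg k) _).comp measurePreserving_snd
  have h_meas : Measurable fun y : ℝ => ENNReal.ofReal (Real.exp (t * y - t ^ 2 / 4)) := by
    fun_prop
  simp only [costStat, observe, add_sub_cancel_left, ENNReal.ofReal_one]
  rw [h_eval.lintegral_comp h_meas]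
  exact lintegral_exp_mul_sub_le_one (hνg k _) t

lemma isVisitExponent_transStat [∀ k i, IsProbabilityMeasure (νg k i)] (s : S) (a : A) (h : Fin H)
    (s' : S) (t : ℝ) : IsVisitExponent M νf νg s a h (transStat M s a h s' t) :=
  isVisitExponent_of_sum_mul_le_one (measurable_transStat M s a h s' t)
    (fun _ => Real.exp_nonneg _)
    (sum_mul_exp_indicator_sub_le_one (M.trans_isKernel s a h).2 s' t)
    fun k τ _ _ => by
      have h_const (z) : transStat M s a h s' t (observe M (τ, z))
          = t * (if τ.1 h.succ = s' then 1 else 0) - M.trans s a h s' * (Real.exp t - 1) := rfl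
      simp only [h_const, lintegral_const, measure_univ, mul_one, le_refl]

end Statistics

section Deviation

section LogTerm

variable {S A : Type*} [Fintype S] [Fintype A] [Nonempty S] [Nonempty A] {H K : ℕ} {δ : ℝ}

lemma one_le_logTerm (hH : 0 < H) (hK : 0 < K) (hδ0 : 0 < δ) (hδ : 4 * δ ≤ 1) :
    1 ≤ logTerm S A H K δ := by
  have h_size : (1 : ℝ) ≤ H * Fintype.card S * Fintype.card A * K := by
    exact_mod_cast Nat.mul_pos (Nat.mul_pos (Nat.mul_pos hH Fintype.card_pos) Fintype.card_pos) hK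
  rw [logTerm, Real.le_log_iff_exp_le (by positivity), le_div_iff₀ hδ0]
  calc Real.exp 1 * δ ≤ 4 * δ := by
        gcongr
        linarith [Real.exp_one_lt_d9]
    _ ≤ _ := hδ.trans h_size

lemma mul_exp_neg_logTerm (hH : 0 < H) (hK : 0 < K) (hδ : 0 < δ) :
    K * Real.exp (-logTerm S A H K δ) = δ / Fintype.card (S × A × Fin H) := by
  rw [logTerm, Real.exp_neg, Real.exp_log (by positivity), inv_div]
  simp only [Fintype.card_prod, Fintype.card_fin, Nat.cast_mul]
  field_simp

lemma mul_exp_neg_two_mul_logTerm_le (hH : 0 < H) (hK : 0 < K) (hδ0 : 0 < δ) (hδ1 : δ ≤ 1) :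
    K * Real.exp (-(2 * logTerm S A H K δ)) ≤ δ / Fintype.card ((S × A × Fin H) × S) := by
  have h_exp : Real.exp (-logTerm S A H K δ) ≤ 1 / Fintype.card S := by
    rw [logTerm, Real.exp_neg, Real.exp_log (by positivity), inv_div]
    have h_size : (1 : ℝ) ≤ H * Fintype.card A * K := by
      exact_mod_cast Nat.mul_pos (Nat.mul_pos hH Fintype.card_pos) hK
    calc δ / (H * Fintype.card S * Fintype.card A * K)
        = δ / (H * Fintype.card A * K) / Fintype.card S := by field_simp
      _ ≤ 1 / Fintype.card S := by
          gcongr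
          exact div_le_one_of_le₀ (hδ1.trans h_size) (by positivity)
  calc K * Real.exp (-(2 * logTerm S A H K δ))
      = K * Real.exp (-logTerm S A H K δ) * Real.exp (-logTerm S A H K δ) := by
        rw [two_mul, neg_add, Real.exp_add, mul_assoc]
    _ ≤ δ / Fintype.card (S × A × Fin H) * (1 / Fintype.card S) := by
        rw [mul_exp_neg_logTerm hH hK hδ0]
        gcongr
    _ = δ / Fintype.card ((S × A × Fin H) × S) := by
        rw [Fintype.card_prod (S × A × Fin H) S, Nat.cast_mul, div_mul_div_comm, mul_one]

end LogTerm

lemma abs_div_sub_le_sqrt_of_tilt {n y m l : ℝ} (hn : 0 < n) (hl : 0 < l)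
    (h_tilt : ∀ t, |t| = 2 * √(l / n) → t * (y - n * m) - n * (t ^ 2 / 4) < l) :
    |y / n - m| ≤ √(l / n) := by
  have h_sq : n * √(l / n) ^ 2 = l := by
    rw [Real.sq_sqrt (by positivity)]
    field_simp
  have hr : 0 < √(l / n) := Real.sqrt_pos.2 (by positivity)
  set r := √(l / n)
  have h_up := h_tilt (2 * r) (abs_of_pos (by positivity))
  have h_lo := h_tilt (-(2 * r)) (by rw [abs_neg, abs_of_pos (by positivity)])
  have h_dev : r * |y - n * m| ≤ r * (n * r) := by
    rw [← abs_of_pos hr, ← abs_mul, abs_of_pos hr, abs_le]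
    constructor <;> linarith
  have h_div : y / n - m = (y - n * m) / n := by field_simp
  rw [h_div, abs_div, abs_of_pos hn, div_le_iff₀ hn, mul_comm r]
  exact le_of_mul_le_mul_left h_dev hr

section Counts

variable {S A : Type*} [DecidableEq S] [DecidableEq A] {H k : ℕ}

lemma countM_le_countN (w : Hist S A H k) (s : S) (a : A) (s' : S) (h : Fin H) :
    countM w s a s' h ≤ countN w s a h :=
  Finset.sum_le_sum fun j _ => by
    split_ifs
    exacts [le_rfl, Nat.zero_le _]

lemma empCost_eq_zero (w : Hist S A H k) {s : S} {a : A} {h : Fin H} (hN : countN w s a h = 0) :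
    empCost w s a h = 0 := by
  have h_visit (j) : visit (w j) s a h = 0 := Finset.sum_eq_zero_iff.1 hN j (Finset.mem_univ j)
  simp only [empCost, h_visit, Nat.cast_zero, mul_zero, Finset.sum_const_zero, zero_div]

lemma empKer_eq_zero (w : Hist S A H k) {s : S} {a : A} {h : Fin H} (hN : countN w s a h = 0)
    (s' : S) : empKer w s a h s' = 0 := by
  have h_countM : countM w s a s' h = 0 := Nat.le_zero.1 (hN ▸ countM_le_countN w s a s' h)
  rw [empKer, h_countM, Nat.cast_zero, zero_div]

lemma den_le_countN {w : Hist S A H k} {s : S} {a : A} {h : Fin H} (hN : 0 < countN w s a h) :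
    den w s a h ≤ countN w s a h :=
  max_le (by exact_mod_cast hN) (sub_le_self _ zero_le_one)

end Counts

variable {S A : Type*} [Fintype S] [Fintype A] [DecidableEq S] [DecidableEq A] {H k K : ℕ} {δ : ℝ}

lemma abs_empCost_sub_cost_le_radiusFn (M : CMDP S A H) (hL : 1 ≤ logTerm S A H K δ)
    (w : Hist S A H k) (s : S) (a : A) (h : Fin H)
    (h_tilt : ∀ t : ℝ, |t| = 2 * √(logTerm S A H K δ / countN w s a h) →
      visitSum s a h (costStat M s a h t) w < logTerm S A H K δ) :
    |empCost w s a h - M.cost s a h| ≤ radiusFn K δ w s a h := by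
  rcases Nat.eq_zero_or_pos (countN w s a h) with hN | hN
  · have h_radius : 1 ≤ radiusFn K δ w s a h := by
      rwa [radiusFn, hN, Nat.cast_zero, max_eq_left zero_le_one, div_one, Real.one_le_sqrt]
    rw [empCost_eq_zero w hN, zero_sub, abs_neg, abs_of_nonneg (M.cost_mem s a h).1]
    exact (M.cost_mem s a h).2.trans h_radius
  · have hN' : (1 : ℝ) ≤ countN w s a h := by exact_mod_cast hN
    rw [empCost, radiusFn, max_eq_right hN']
    simp only [visitSum_costStat] at h_tilt
    exact abs_div_sub_le_sqrt_of_tilt (by positivity) (by positivity) h_tilt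

lemma abs_sub_empKer_le_radiusKer_of_countN_eq_zero (hL : 1 ≤ logTerm S A H K δ) {q : ℝ}
    (hq : q ∈ Set.Icc (0 : ℝ) 1) (w : Hist S A H k) {s : S} {a : A} {h : Fin H}
    (hN : countN w s a h = 0) (s' : S) :
    |q - empKer w s a h s'| ≤ radiusKer K δ w s a h s' := by
  have h_den : den w s a h = 1 := by
    rw [den, hN, Nat.cast_zero, max_eq_left (by norm_num)]
  rw [radiusKer, empKer_eq_zero w hN, h_den, zero_mul, zero_div, Real.sqrt_zero, sub_zero,
    abs_of_nonneg hq.1]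
  linarith [hq.2]

lemma abs_sub_empKer_le_radiusKer (hL : 0 ≤ logTerm S A H K δ) {q : ℝ} (w : Hist S A H k) {s : S}
    {a : A} {h : Fin H} (hN : 0 < countN w s a h) (s' : S)
    (h_le : empKer w s a h s'
      ≤ q + 2 * √(empKer w s a h s' * (logTerm S A H K δ / countN w s a h)))
    (h_ge : q ≤ empKer w s a h s'
      + 2 * √(empKer w s a h s' * (logTerm S A H K δ / countN w s a h))
      + 4 * (logTerm S A H K δ / countN w s a h)) :
    |q - empKer w s a h s'| ≤ radiusKer K δ w s a h s' := by
  have hx := empKer_nonneg w s a h s'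
  have hD := den_pos w s a h
  have h_div : logTerm S A H K δ / countN w s a h ≤ logTerm S A H K δ / den w s a h :=
    div_le_div_of_nonneg_left hL hD (den_le_countN hN)
  have h_sqrt : √(empKer w s a h s' * (logTerm S A H K δ / countN w s a h))
      ≤ √(empKer w s a h s' * (logTerm S A H K δ / den w s a h)) := by gcongr
  have h_nonneg := div_nonneg hL hD.le
  rw [radiusKer_eq hL, ← Real.sqrt_mul hx, Real.sq_sqrt h_nonneg, abs_le]
  constructor <;> linarith

lemma visitSum_transStat_eq_mul (M : CMDP S A H) (w : Hist S A H k) {s : S} {a : A} {h : Fin H}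
    (hN : 0 < countN w s a h) (s' : S) (t : ℝ) :
    visitSum s a h (transStat M s a h s' t) w
      = countN w s a h * (t * empKer w s a h s' - M.trans s a h s' * (Real.exp t - 1)) := by
  have hN' : (1 : ℝ) ≤ countN w s a h := by exact_mod_cast hN
  rw [visitSum_transStat, empKer, max_eq_right hN']
  field_simp

lemma exists_tilts_abs_trans_sub_empKer_le (M : CMDP S A H) (hL : 1 ≤ logTerm S A H K δ) (s : S)
    (a : A) (h : Fin H) (s' : S) :
    ∃ t u : ℕ → ℝ, ∀ (k : ℕ) (w : Hist S A H k),
      visitSum s a h (transStat M s a h s' (t (countN w s a h))) w < 2 * logTerm S A H K δ →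
      visitSum s a h (transStat M s a h s' (u (countN w s a h))) w < 2 * logTerm S A H K δ →
      |M.trans s a h s' - empKer w s a h s'| ≤ radiusKer K δ w s a h s' := by
  obtain ⟨h_nonneg, h_sum⟩ := M.trans_isKernel s a h
  have h_le_one : M.trans s a h s' ≤ 1 :=
    h_sum ▸ Finset.single_le_sum (fun i _ => h_nonneg i) (Finset.mem_univ s')
  have hL0 : 0 ≤ logTerm S A H K δ := zero_le_one.trans hL
  choose t ht using fun n : ℕ => exists_tilt_of_add_two_mul_sqrt_lt (h_nonneg s')
    (div_nonneg hL0 n.cast_nonneg)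
  choose u hu using fun n : ℕ => exists_tilt_of_lt_sub_two_mul_sqrt (M.trans s a h s')
    (div_nonneg hL0 n.cast_nonneg)
  refine ⟨t, u, fun k w h_up h_lo => ?_⟩
  rcases Nat.eq_zero_or_pos (countN w s a h) with hN | hN
  · exact abs_sub_empKer_le_radiusKer_of_countN_eq_zero hL ⟨h_nonneg s', h_le_one⟩ w hN s'
  have hN' : (0 : ℝ) < countN w s a h := by exact_mod_cast hN
  have h_scale : 2 * logTerm S A H K δ
      = countN w s a h * (2 * (logTerm S A H K δ / countN w s a h)) := by field_simp
  rw [visitSum_transStat_eq_mul M w hN, h_scale, mul_lt_mul_iff_right₀ hN'] at h_up h_lo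
  refine abs_sub_empKer_le_radiusKer hL0 w hN s' ?_ ?_
  · exact not_lt.1 fun h_lt => h_up.not_ge (ht _ _ h_lt)
  · exact not_lt.1 fun h_lt => h_lo.not_ge (hu _ _ (empKer_nonneg w s a h s') h_lt)

end Deviation

section ConfidenceEvent

lemma measure_iUnion_le_of_forall_le_div {Ω ι : Type*} [MeasurableSpace Ω] [Fintype ι]
    {μ : Measure Ω} {T : ι → Set Ω} {c : ℝ} (hc : 0 ≤ c)
    (hT : ∀ i, μ (T i) ≤ ENNReal.ofReal (c / Fintype.card ι)) : μ (⋃ i, T i) ≤ ENNReal.ofReal c :=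
  calc μ (⋃ i, T i) ≤ ∑ i, μ (T i) := measure_iUnion_fintype_le _ _
    _ ≤ ∑ _i : ι, ENNReal.ofReal (c / Fintype.card ι) := Finset.sum_le_sum fun i _ => hT i
    _ = ENNReal.ofReal (Fintype.card ι * (c / Fintype.card ι)) := by
        rw [Finset.sum_const, Finset.card_univ, ENNReal.ofReal_mul (Nat.cast_nonneg _),
          ENNReal.ofReal_natCast, nsmul_eq_mul]
    _ ≤ ENNReal.ofReal c := by
        rw [mul_div_left_comm]
        exact ENNReal.ofReal_le_ofReal (mul_le_of_le_one_right hc (div_self_le_one _))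

variable {S A : Type*} [Fintype S] [Fintype A] [DecidableEq S] [DecidableEq A] {H : ℕ}

/-- The records `w` are accurate: the costs and the transition kernel of `M` lie within the
confidence radii of their estimates. -/
def IsAccurate (M : CMDP S A H) (K : ℕ) (δ : ℝ) {k : ℕ} (w : Hist S A H k) : Prop :=
  (∀ s a h, |empCost w s a h - M.cost s a h| ≤ radiusFn K δ w s a h) ∧ M.trans ∈ confSet K δ w

/-- The confidence event: the records available before each of the `K` episodes are accurate. -/
def confEvent (M : CMDP S A H) (K : ℕ) (δ : ℝ) : Set (Hist S A H K) :=
  {ω | ∀ k : Fin K, IsAccurate M K δ (Fin.take k k.isLt.le ω)}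

variable [MeasurableSpace S] [DiscreteMeasurableSpace S] [MeasurableSpace A]
  [DiscreteMeasurableSpace A] {M : CMDP S A H} {νf νg : ℕ → S × A × Fin H → Measure ℝ}
  [∀ k i, IsProbabilityMeasure (νf k i)] {K : ℕ} {δ : ℝ}

lemma runLaw_exists_not_le [∀ k i, IsProbabilityMeasure (νg k i)] (L : Learner S A H) {s : S}
    {a : A} {h : Fin H} {x y : ℕ → Episode S A H → ℝ}
    (hx : ∀ n, IsVisitExponent M νf νg s a h (x n))
    (hy : ∀ n, IsVisitExponent M νf νg s a h (y n)) {c : ℝ} {good : ∀ k, Hist S A H k → Prop}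
    (h_good : ∀ k (w : Hist S A H k), visitSum s a h (x (countN w s a h)) w < c →
      visitSum s a h (y (countN w s a h)) w < c → good k w) (K : ℕ) :
    runLaw M νf νg L K {ω | ∃ k : Fin K, ¬ good k (Fin.take k k.isLt.le ω)}
      ≤ ENNReal.ofReal (2 * (K * Real.exp (-c))) := by
  set tail : (ℕ → Episode S A H → ℝ) → Set (Hist S A H K) := fun x => {ω | ∃ k : Fin K,
    c ≤ visitSum s a h (x (countN (Fin.take k k.isLt.le ω) s a h)) (Fin.take k k.isLt.le ω)}
  have h_subset : {ω : Hist S A H K | ∃ k : Fin K, ¬ good k (Fin.take k k.isLt.le ω)}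
      ⊆ tail x ∪ tail y := by
    rintro ω ⟨k, hk⟩
    by_contra h_notMem
    simp only [tail, Set.mem_union, Set.mem_ofPred_eq, not_or, not_exists, not_le] at h_notMem
    exact hk (h_good k _ (h_notMem.1 k) (h_notMem.2 k))
  calc runLaw M νf νg L K _ ≤ runLaw M νf νg L K (tail x) + runLaw M νf νg L K (tail y) :=
        (measure_mono h_subset).trans (measure_union_le _ _)
    _ ≤ K * ENNReal.ofReal (Real.exp (-c)) + K * ENNReal.ofReal (Real.exp (-c)) :=
        add_le_add (runLaw_exists_le_visitSum_le L hx K c)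
          (runLaw_exists_le_visitSum_le L hy K c)
    _ = ENNReal.ofReal (2 * (K * Real.exp (-c))) := by
        rw [← two_mul, ENNReal.ofReal_mul zero_le_two, ENNReal.ofReal_mul (Nat.cast_nonneg _),
          ENNReal.ofReal_natCast, ENNReal.ofReal_ofNat]

lemma runLaw_exists_not_abs_empCost_sub_le_le (hνg : ∀ k i, IsNoise (νg k i)) (L : Learner S A H)
    (hL : 1 ≤ logTerm S A H K δ) (s : S) (a : A) (h : Fin H) :
    runLaw M νf νg L K {ω | ∃ k : Fin K,
      ¬ |empCost (Fin.take k k.isLt.le ω) s a h - M.cost s a h|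
        ≤ radiusFn K δ (Fin.take k k.isLt.le ω) s a h}
      ≤ ENNReal.ofReal (2 * (K * Real.exp (-logTerm S A H K δ))) := by
  have := fun k i => (hνg k i).1
  set r : ℕ → ℝ := fun n => 2 * √(logTerm S A H K δ / n)
  have hr_nonneg (n) : 0 ≤ r n := by positivity
  refine runLaw_exists_not_le L (fun n => isVisitExponent_costStat hνg s a h (r n))
    (fun n => isVisitExponent_costStat hνg s a h (-r n))
    (good := fun k w => |empCost w s a h - M.cost s a h| ≤ radiusFn K δ w s a h)
    (fun k w h_up h_lo => abs_empCost_sub_cost_le_radiusFn M hL w s a h fun t ht => ?_) K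
  rcases (abs_eq (hr_nonneg _)).1 ht with rfl | rfl
  exacts [h_up, h_lo]

lemma runLaw_exists_not_abs_trans_sub_empKer_le_le [∀ k i, IsProbabilityMeasure (νg k i)]
    (L : Learner S A H) (hL : 1 ≤ logTerm S A H K δ) (s : S) (a : A) (h : Fin H) (s' : S) :
    runLaw M νf νg L K {ω | ∃ k : Fin K,
      ¬ |M.trans s a h s' - empKer (Fin.take k k.isLt.le ω) s a h s'|
        ≤ radiusKer K δ (Fin.take k k.isLt.le ω) s a h s'}
      ≤ ENNReal.ofReal (2 * (K * Real.exp (-(2 * logTerm S A H K δ)))) := by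
  obtain ⟨t, u, h_tilt⟩ := exists_tilts_abs_trans_sub_empKer_le M hL s a h s'
  exact runLaw_exists_not_le L (fun n => isVisitExponent_transStat s a h s' (t n))
    (fun n => isVisitExponent_transStat s a h s' (u n))
    (good := fun k w => |M.trans s a h s' - empKer w s a h s'| ≤ radiusKer K δ w s a h s')
    h_tilt K

lemma runLaw_exists_not_cost_accurate_le [Nonempty S] [Nonempty A] (hνg : ∀ k i, IsNoise (νg k i))
    (L : Learner S A H) (hH : 0 < H) (hK : 0 < K) (hδ : 0 < δ) (hL : 1 ≤ logTerm S A H K δ) :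
    runLaw M νf νg L K {ω | ∃ k : Fin K, ¬ ∀ s a h,
      |empCost (Fin.take k k.isLt.le ω) s a h - M.cost s a h|
        ≤ radiusFn K δ (Fin.take k k.isLt.le ω) s a h} ≤ ENNReal.ofReal (2 * δ) := by
  set bad : S × A × Fin H → Set (Hist S A H K) := fun i => {ω | ∃ k : Fin K,
    ¬ |empCost (Fin.take k k.isLt.le ω) i.1 i.2.1 i.2.2 - M.cost i.1 i.2.1 i.2.2|
      ≤ radiusFn K δ (Fin.take k k.isLt.le ω) i.1 i.2.1 i.2.2}
  calc runLaw M νf νg L K _ ≤ runLaw M νf νg L K (⋃ i, bad i) := measure_mono <| by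
        rintro ω ⟨k, hk⟩
        push Not at hk
        obtain ⟨s, a, h, h_far⟩ := hk
        exact Set.mem_iUnion.2 ⟨(s, a, h), k, h_far.not_ge⟩
    _ ≤ ENNReal.ofReal (2 * δ) := by
        refine measure_iUnion_le_of_forall_le_div (by positivity) fun i =>
          (runLaw_exists_not_abs_empCost_sub_le_le hνg L hL _ _ _).trans_eq ?_
        rw [mul_exp_neg_logTerm hH hK hδ, mul_div_assoc]

lemma runLaw_exists_trans_notMem_confSet_le [∀ k i, IsProbabilityMeasure (νg k i)] [Nonempty S]
    [Nonempty A] (L : Learner S A H) (hH : 0 < H) (hK : 0 < K) (hδ0 : 0 < δ) (hδ1 : δ ≤ 1)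
    (hL : 1 ≤ logTerm S A H K δ) :
    runLaw M νf νg L K {ω | ∃ k : Fin K, M.trans ∉ confSet K δ (Fin.take k k.isLt.le ω)}
      ≤ ENNReal.ofReal (2 * δ) := by
  set bad : (S × A × Fin H) × S → Set (Hist S A H K) := fun i => {ω | ∃ k : Fin K,
    ¬ |M.trans i.1.1 i.1.2.1 i.1.2.2 i.2
        - empKer (Fin.take k k.isLt.le ω) i.1.1 i.1.2.1 i.1.2.2 i.2|
      ≤ radiusKer K δ (Fin.take k k.isLt.le ω) i.1.1 i.1.2.1 i.1.2.2 i.2}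
  calc runLaw M νf νg L K _ ≤ runLaw M νf νg L K (⋃ i, bad i) := measure_mono <| by
        rintro ω ⟨k, hk⟩
        by_contra h_close
        simp only [bad, Set.mem_iUnion, Set.mem_ofPred_eq, not_exists, not_not] at h_close
        exact hk ⟨M.trans_isKernel, fun s a h s' => h_close ((s, a, h), s') k⟩
    _ ≤ ENNReal.ofReal (2 * δ) := by
        refine measure_iUnion_le_of_forall_le_div (by positivity) fun i =>
          (runLaw_exists_not_abs_trans_sub_empKer_le_le L hL _ _ _ _).trans ?_
        rw [mul_div_assoc]
        gcongr
        exact mul_exp_neg_two_mul_logTerm_le hH hK hδ0 hδ1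

theorem runLaw_compl_confEvent_le [Nonempty S] [Nonempty A] (hνg : ∀ k i, IsNoise (νg k i))
    (L : Learner S A H) (hH : 0 < H) (hδ0 : 0 < δ) (hδ : 4 * δ ≤ 1) :
    runLaw M νf νg L K (confEvent M K δ)ᶜ ≤ ENNReal.ofReal (4 * δ) := by
  have := fun k i => (hνg k i).1
  rcases Nat.eq_zero_or_pos K with rfl | hK
  · have h_univ : confEvent M 0 δ = Set.univ := Set.eq_univ_of_forall fun ω k => k.elim0
    simp only [h_univ, Set.compl_univ, measure_empty, zero_le]
  have hL : 1 ≤ logTerm S A H K δ := one_le_logTerm hH hK hδ0 hδ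
  have h_subset : (confEvent M K δ)ᶜ ⊆
      {ω | ∃ k : Fin K, ¬ ∀ s a h, |empCost (Fin.take k k.isLt.le ω) s a h - M.cost s a h|
        ≤ radiusFn K δ (Fin.take k k.isLt.le ω) s a h} ∪
      {ω | ∃ k : Fin K, M.trans ∉ confSet K δ (Fin.take k k.isLt.le ω)} := by
    intro ω hω
    obtain ⟨k, hk⟩ := not_forall.1 hω
    exact (not_and_or.1 hk).imp (⟨k, ·⟩) (⟨k, ·⟩)
  calc runLaw M νf νg L K (confEvent M K δ)ᶜ ≤ ENNReal.ofReal (2 * δ) + ENNReal.ofReal (2 * δ) :=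
        ((measure_mono h_subset).trans (measure_union_le _ _)).trans <|
          add_le_add (runLaw_exists_not_cost_accurate_le hνg L hH hK hδ0 hL)
            (runLaw_exists_trans_notMem_confSet_le L hH hK hδ0 (by linarith) hL)
    _ = ENNReal.ofReal (4 * δ) := by
        rw [← ENNReal.ofReal_add (by positivity) (by positivity)]
        ring_nf

lemma exists_measurableSet_subset_confEvent [Nonempty S] [Nonempty A]
    (hνg : ∀ k i, IsNoise (νg k i)) (L : Learner S A H) (hH : 0 < H) (hδ0 : 0 < δ)
    (hδ : 4 * δ ≤ 1) :
    ∃ E ⊆ confEvent M K δ, MeasurableSet E ∧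
      ENNReal.ofReal (1 - 4 * δ) ≤ runLaw M νf νg L K E := by
  have := fun k i => (hνg k i).1
  have h_meas := measurableSet_toMeasurable (runLaw M νf νg L K) (confEvent M K δ)ᶜ
  refine ⟨(toMeasurable (runLaw M νf νg L K) (confEvent M K δ)ᶜ)ᶜ,
    Set.compl_subset_comm.1 (subset_toMeasurable _ _), h_meas.compl, ?_⟩
  rw [prob_compl_eq_one_sub h_meas, measure_toMeasurable, ENNReal.ofReal_sub _ (by positivity),
    ENNReal.ofReal_one]
  exact tsub_le_tsub_left (runLaw_compl_confEvent_le hνg L hH hδ0 hδ) 1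

end ConfidenceEvent

section Safety

lemma CMDP.nonempty_state {S A : Type*} [Fintype S] [Fintype A] {H : ℕ} (M : CMDP S A H) :
    Nonempty S := by
  by_contra h_empty
  rw [not_nonempty_iff] at h_empty
  simpa using M.init_sum

lemma IsPolicy.nonempty_action {S A : Type*} [Nonempty S] [Fintype A] {H : ℕ} (hH : 0 < H)
    {π : Pol S A H} (hπ : IsPolicy π) : Nonempty A := by
  by_contra h_empty
  rw [not_nonempty_iff] at h_empty
  simpa using (hπ (Classical.arbitrary S) ⟨0, hH⟩).2

variable {S A : Type*} [Fintype S] [Fintype A] [DecidableEq S] [DecidableEq A] {H k K : ℕ} {δ : ℝ}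
  {M : CMDP S A H} {w : Hist S A H k}

lemma IsAccurate.value_le_budget [Nonempty S] [Nonempty A] (hH : 0 < H) (hK : 0 < K)
    (hL : 1 ≤ logTerm S A H K δ) (hw : IsAccurate M K δ w) {x : Pol S A H × Ker S A H}
    (hx : x ∈ feasibleSet M.init M.budget K δ w) :
    value M.init x.1 M.cost M.trans ≤ M.budget := by
  obtain ⟨hπ, hQ, h_budget⟩ := hx
  calc value M.init x.1 M.cost M.trans
      ≤ value M.init x.1 (fun s a h => M.cost s a h + bonusU K δ w s a h) x.2 :=
        value_le_value_add_bonusU hH hK hL M.init_nonneg M.init_sum hπ M.cost_mem hw.2 hQ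
    _ ≤ value M.init x.1 (pessCost K δ w) x.2 :=
        value_mono M.init_nonneg hπ hQ.1 fun s a h => by
          rw [pessCost]
          linarith [(abs_le.1 (hw.1 s a h)).1]
    _ ≤ M.budget := h_budget

lemma IsAccurate.mem_feasibleSet {π : Pol S A H} (hπ : IsPolicy π) (hw : IsAccurate M K δ w)
    (h_slack : value M.init π (fun s a h => 2 * radiusFn K δ w s a h + bonusU K δ w s a h) M.trans
      ≤ M.budget - value M.init π M.cost M.trans) :
    (π, M.trans) ∈ feasibleSet M.init M.budget K δ w := by
  refine ⟨hπ, hw.2, ?_⟩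
  calc value M.init π (pessCost K δ w) M.trans
      ≤ value M.init π (fun s a h =>
          M.cost s a h + (2 * radiusFn K δ w s a h + bonusU K δ w s a h)) M.trans :=
        value_mono M.init_nonneg hπ M.trans_isKernel fun s a h => by
          rw [pessCost]
          linarith [(abs_le.1 (hw.1 s a h)).2]
    _ ≤ M.budget := by
        rw [value_add]
        linarith

end Safety

end DOPEPlus

open DOPEPlus

theorem mainTheorem3_general {S A : Type*} [Fintype S] [Fintype A] [DecidableEq S] [DecidableEq A]
    [MeasurableSpace S] [DiscreteMeasurableSpace S] [MeasurableSpace A]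
    [DiscreteMeasurableSpace A] {H : ℕ} (hH : 0 < H) (M : CMDP S A H) (πb : Pol S A H)
    (hπb : IsPolicy πb) (hsafe : value M.init πb M.cost M.trans ≤ M.budget)
    (νf νg : ℕ → S × A × Fin H → Measure ℝ) [∀ k i, IsProbabilityMeasure (νf k i)]
    (hνg : ∀ k i, IsNoise (νg k i)) (K K₀ : ℕ) (δ : ℝ) (hδ : 0 < δ) (L : Learner S A H)
    (hL : ∀ k < K, ∀ w : Hist S A H k, (k < K₀ → L.policy k w = πb) ∧
      (K₀ ≤ k → (feasibleSet M.init M.budget K δ w).Nonempty →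
        (L.policy k w, L.kernel k w) ∈ feasibleSet M.init M.budget K δ w)) :
    ∃ E : Set (Hist S A H K), MeasurableSet E ∧
      ENNReal.ofReal (1 - 4 * δ) ≤ runLaw M νf νg L K E ∧
      ∀ ω ∈ E,
        (∀ k : Fin K, Computed M K K₀ δ (Fin.take k k.isLt.le ω) →
          value M.init (playedPolicy L ω k) M.cost M.trans ≤ M.budget) ∧
        ((∀ k : Fin K, Computed M K K₀ δ (Fin.take k k.isLt.le ω)) →
          violation M (playedPolicy L ω) = 0) ∧
        (∀ k : Fin K,
          (K₀ ≤ k → value M.init πb (fun s a h =>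
            2 * radiusFn K δ (Fin.take k k.isLt.le ω) s a h
              + bonusU K δ (Fin.take k k.isLt.le ω) s a h) M.trans
            ≤ M.budget - value M.init πb M.cost M.trans) →
          Computed M K K₀ δ (Fin.take k k.isLt.le ω)) := by
  have := M.nonempty_state
  have := hπb.nonempty_action hH
  rcases le_or_gt 1 (4 * δ) with hδ_large | hδ_small
  · exact ⟨∅, .empty, by simp [hδ_large], fun ω hω => hω.elim⟩
  obtain ⟨E, hE_conf, hE_meas, hE_prob⟩ := exists_measurableSet_subset_confEvent (M := M)
    (νf := νf) (K := K) hνg L hH hδ hδ_small.le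
  refine ⟨E, hE_meas, hE_prob, fun ω hω => ?_⟩
  have h_safe (k : Fin K) (hk : Computed M K K₀ δ (Fin.take k k.isLt.le ω)) :
      value M.init (playedPolicy L ω k) M.cost M.trans ≤ M.budget := by
    obtain ⟨h_baseline, h_feasible⟩ := hL k k.isLt (Fin.take k k.isLt.le ω)
    rcases lt_or_ge (k : ℕ) K₀ with h_lt | h_ge
    · rwa [playedPolicy, h_baseline h_lt]
    · exact (hE_conf hω k).value_le_budget hH k.pos (one_le_logTerm hH k.pos hδ hδ_small.le)
        (h_feasible h_ge (hk.resolve_left h_ge.not_gt))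
  refine ⟨h_safe, fun h_all => ?_, fun k h_slack => ?_⟩
  · exact Finset.sum_eq_zero fun k _ => max_eq_left (sub_nonpos.2 (h_safe k (h_all k)))
  · exact (lt_or_ge (k : ℕ) K₀).imp_right fun h_ge =>
      ⟨_, (hE_conf hω k).mem_feasibleSet hπb (h_slack h_ge)⟩

theorem mainTheorem3 {S A : Type*} [Fintype S] [Fintype A] [DecidableEq S] [DecidableEq A]
    [MeasurableSpace S] [DiscreteMeasurableSpace S] [MeasurableSpace A]
    [DiscreteMeasurableSpace A] {H : ℕ} (M : DOPEPlus.CMDP S A H)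
    (hC : M.budget ∈ Set.Ioo (0 : ℝ) (H : ℝ))
    (πb : DOPEPlus.Pol S A H) (hπb : DOPEPlus.IsPolicy πb)
    (hsafe : DOPEPlus.value M.init πb M.cost M.trans < M.budget)
    (νf νg : ℕ → S × A × Fin H → Measure ℝ)
    (hνf : ∀ k i, DOPEPlus.IsNoise (νf k i)) (hνg : ∀ k i, DOPEPlus.IsNoise (νg k i))
    (K K₀ : ℕ) (δ : ℝ) (hδ : δ ∈ Set.Ioo (0 : ℝ) 1)
    (L : DOPEPlus.Learner S A H) (hL : DOPEPlus.IsDOPEPlus M πb K K₀ δ L) :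
    ∃ E : Set (DOPEPlus.Hist S A H K), MeasurableSet E ∧
      ENNReal.ofReal (1 - 14 * δ) ≤ DOPEPlus.runLaw M νf νg L K E ∧
      ∀ ω ∈ E,
        -- every policy computed by DOPE+ satisfies the true constraint
        (∀ k : Fin K, DOPEPlus.Computed M K K₀ δ (Fin.take k k.isLt.le ω) →
          DOPEPlus.value M.init (DOPEPlus.playedPolicy L ω k) M.cost M.trans ≤ M.budget) ∧
        -- if all `K` policies are computed, the hard constraint violation is zero
        ((∀ k : Fin K, DOPEPlus.Computed M K K₀ δ (Fin.take k k.isLt.le ω)) →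
          DOPEPlus.violation M (DOPEPlus.playedPolicy L ω) = 0) ∧
        -- DOPE+ does compute the policy of every episode at which `K₀` is large enough in that
        -- the pessimism accumulated along the baseline policy is at most its slack
        (∀ k : Fin K,
          (K₀ ≤ k → DOPEPlus.value M.init πb (fun s a h =>
            2 * DOPEPlus.radiusFn K δ (Fin.take k k.isLt.le ω) s a h
              + DOPEPlus.bonusU K δ (Fin.take k k.isLt.le ω) s a h) M.trans
            ≤ M.budget - DOPEPlus.value M.init πb M.cost M.trans) →
          DOPEPlus.Computed M K K₀ δ (Fin.take k k.isLt.le ω)) := by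
  have := fun k i => (hνf k i).1
  obtain ⟨E, hE_meas, hE_prob, hE⟩ := mainTheorem3_general (by exact_mod_cast hC.1.trans hC.2) M πb
    hπb hsafe.le νf νg hνg K K₀ δ hδ.1 L
    fun k hk w => ⟨(hL k hk w).1, fun h_ge h_ne => ((hL k hk w).2 h_ge h_ne).1⟩
  exact ⟨E, hE_meas, (ENNReal.ofReal_le_ofReal (by linarith [hδ.1])).trans hE_prob, hE⟩
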